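/- Let $M$ be a smooth ($C^\infty$) Hausdorff second countable $n$-dimensional manifold without boundary, and let $g$ be a smooth Lorentzian metric on $M$ of signature $(-,+,\dots,+)$, time-oriented by a continuous timelike vector field; that is, let $(M,g)$ be a spacetime. Let $\operatorname{vol}_g$ be its volume measure, given in local coordinates by $\sqrt{|\det(g_{ij})|}\,dx^1\cdots dx^n$, let $I^-(x)$ be the chronological past of $x$, i.e. the set of all points $y$ such that there is a piecewise smooth future-directed timelike curve from $y$ to $x$, and let $$\tau(x) := \operatorname{vol}_g\big(I^-(x)\big)\in[0,\infty],\qquad x\in M,$$ be the cosmological volume function. Causal curves are locally Lipschitz curves whose velocity is, at almost every parameter, a future-directed causal (in particular non-zero) vector; such a curve $\gamma:(a,b]\to M$, $-\infty\le a<b<\infty$, is past-inextendible if $\lim_{s\to a^+}\gamma(s)$ does not exist in $M$. Suppose that $\tau$ is regular, i.e. 1. $\tau(x)<\infty$ for all $x\in M$, and 2. $\tau(\gamma(s))\to 0$ as $s\to a^+$ for every past-inextendible causal curve $\gamma:(a,b]\to M$. Then $(M,g)$ is globally hyperbolic: it is strongly causal (every point has arbitrarily small open neighbourhoods $V$ such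 that every causal curve with endpoints in $V$ is contained in $V$), and for all $p,q\in M$ the causal diamond $J^+(p)\cap J^-(q)$ is compact, where $J^+(p)$ (resp. $J^-(q)$) is the set of points that equal $p$ (resp. $q$) or can be reached from $p$ (resp. can reach $q$) by a causal curve. -/

import Mathlib

open Set Filter Topology MeasureTheory
open scoped Manifold ContDiff ENNReal

/-- The structure of a spacetime on a smooth `n`-manifold `M`: a smooth Lorentzian metric of
signature `(-,+,…,+)` and a time orientation, given by a continuous timelike vector field. -/
structure Spacetime (n : ℕ) (M : Type*) [TopologicalSpace M]
    [ChartedSpace (EuclideanSpace ℝ (Fin n)) M] [IsManifold (𝓡 n) ∞ M] where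
  /-- The Lorentzian metric, as a family of bilinear forms on the tangent spaces. -/
  metric : ∀ x : M, TangentSpace (𝓡 n) x →L[ℝ] TangentSpace (𝓡 n) x →L[ℝ] ℝ
  symm : ∀ (x : M) (v w : TangentSpace (𝓡 n) x), metric x v w = metric x w v
  /-- Signature `(-,+,…,+)`: some vector is negative, and the form is positive definite on its
  orthogonal complement. -/
  signature : ∀ x : M, ∃ v : TangentSpace (𝓡 n) x, metric x v v < 0 ∧
    ∀ w : TangentSpace (𝓡 n) x, metric x v w = 0 → w ≠ 0 → 0 < metric x w w
  contMDiff : ContMDiff (𝓡 n)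
    ((𝓡 n).prod 𝓘(ℝ, EuclideanSpace ℝ (Fin n) →L[ℝ] EuclideanSpace ℝ (Fin n) →L[ℝ] ℝ)) ∞
    (fun x ↦ Bundle.TotalSpace.mk'
      (EuclideanSpace ℝ (Fin n) →L[ℝ] EuclideanSpace ℝ (Fin n) →L[ℝ] ℝ) x (metric x))
  /-- The vector field that defines the time orientation. -/
  timeField : ∀ x : M, TangentSpace (𝓡 n) x
  continuous_timeField :
    Continuous (fun x ↦ (⟨x, timeField x⟩ : TangentBundle (𝓡 n) M))
  timeField_timelike : ∀ x : M, metric x (timeField x) (timeField x) < 0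

namespace Spacetime

variable {n : ℕ} {M : Type*} [TopologicalSpace M]
  [ChartedSpace (EuclideanSpace ℝ (Fin n)) M] [IsManifold (𝓡 n) ∞ M]

/-- Future-directed timelike tangent vectors. -/
def FutureTimelike (g : Spacetime n M) (x : M) (v : TangentSpace (𝓡 n) x) : Prop :=
  g.metric x v v < 0 ∧ g.metric x (g.timeField x) v < 0

/-- Future-directed causal tangent vectors. The second condition forces `v ≠ 0`. -/
def FutureCausal (g : Spacetime n M) (x : M) (v : TangentSpace (𝓡 n) x) : Prop :=
  g.metric x v v ≤ 0 ∧ g.metric x (g.timeField x) v < 0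

/-- `x` and `y` are the endpoints of a smooth future-directed timelike curve `[0,1] → M`. -/
def TimelikeSegment (g : Spacetime n M) (x y : M) : Prop :=
  ∃ γ : ℝ → M, ContMDiffOn 𝓘(ℝ) (𝓡 n) ∞ γ (Icc 0 1) ∧
    (∀ t ∈ Icc (0 : ℝ) 1,
      g.FutureTimelike (γ t) (mfderivWithin 𝓘(ℝ) (𝓡 n) γ (Icc 0 1) t (1 : ℝ))) ∧
    γ 0 = x ∧ γ 1 = y

/-- The chronological relation `x ≪ y`: there is a piecewise smooth future-directed timelike
curve (a finite, nonempty concatenation of smooth ones) from `x` to `y`. -/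
def Chronological (g : Spacetime n M) : M → M → Prop :=
  Relation.TransGen g.TimelikeSegment

/-- The chronological past `I⁻(x)`. -/
def chronPast (g : Spacetime n M) (x : M) : Set M := {y | g.Chronological y x}

/-- `γ`, restricted to the interval `s`, is a future-directed causal curve: it is continuous,
locally Lipschitz in charts, and its velocity is a future-directed causal vector at almost every
time. (Where `γ` is not differentiable, `mfderiv` is zero, which is not a causal vector, so the
last condition includes differentiability almost everywhere.) -/
def IsCausalCurveOn (g : Spacetime n M) (γ : ℝ → M) (s : Set ℝ) : Prop :=
  ContinuousOn γ s ∧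
  (∀ t ∈ s, ∃ K : NNReal, ∃ u ∈ 𝓝[s] t,
    LipschitzOnWith K (chartAt (EuclideanSpace ℝ (Fin n)) (γ t) ∘ γ) u) ∧
  ∀ᵐ t : ℝ, t ∈ s → g.FutureCausal (γ t) (mfderiv 𝓘(ℝ) (𝓡 n) γ t (1 : ℝ))

/-- The causal relation `x ≤ y`: either `x = y`, or there is a future-directed causal curve from
`x` to `y`. -/
def Causal (g : Spacetime n M) (x y : M) : Prop :=
  x = y ∨ ∃ γ : ℝ → M, g.IsCausalCurveOn γ (Icc 0 1) ∧ γ 0 = x ∧ γ 1 = y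

/-- The causal future `J⁺(x)`. -/
def causalFuture (g : Spacetime n M) (x : M) : Set M := {y | g.Causal x y}

/-- The causal past `J⁻(x)`. -/
def causalPast (g : Spacetime n M) (x : M) : Set M := {y | g.Causal y x}

/-- A past-inextendible causal curve: a future-directed causal curve without past endpoint,
parametrized by the half-line `(-∞, 0]` (to which every interval containing its right endpoint
but not its left endpoint is diffeomorphic). -/
def IsPastInextendible (g : Spacetime n M) (γ : ℝ → M) : Prop :=
  g.IsCausalCurveOn γ (Iic 0) ∧ ¬ ∃ p : M, Tendsto γ atBot (𝓝 p)

/-- An open set is causally convex if no causal curve meets it in a disconnected set, that is, if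
every causal curve with endpoints in the set stays in the set. -/
def IsCausallyConvex (g : Spacetime n M) (V : Set M) : Prop :=
  ∀ γ : ℝ → M, g.IsCausalCurveOn γ (Icc 0 1) → γ 0 ∈ V → γ 1 ∈ V → ∀ t ∈ Icc (0 : ℝ) 1, γ t ∈ V

/-- Strong causality: every point has arbitrarily small causally convex open neighbourhoods. -/
def IsStronglyCausal (g : Spacetime n M) : Prop :=
  ∀ p : M, ∀ U ∈ 𝓝 p, ∃ V ⊆ U, IsOpen V ∧ p ∈ V ∧ g.IsCausallyConvex V

/-- Global hyperbolicity: strong causality and compactness of all causal diamonds. -/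
def IsGloballyHyperbolic (g : Spacetime n M) : Prop :=
  g.IsStronglyCausal ∧ ∀ p q : M, IsCompact (g.causalFuture p ∩ g.causalPast q)

/-- The matrix `g_ij = g(∂_i, ∂_j)` of the metric in the coordinates of the chart `e`. -/
noncomputable def gram (g : Spacetime n M)
    (e : OpenPartialHomeomorph M (EuclideanSpace ℝ (Fin n))) (y : EuclideanSpace ℝ (Fin n)) :
    Matrix (Fin n) (Fin n) ℝ :=
  Matrix.of fun i j ↦ g.metric (e.symm y)
    (mfderiv (𝓡 n) (𝓡 n) e.symm y (EuclideanSpace.single i (1 : ℝ)))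
    (mfderiv (𝓡 n) (𝓡 n) e.symm y (EuclideanSpace.single j (1 : ℝ)))

/-- Change of coordinates for the matrix of the metric. -/
lemma gram_change (g : Spacetime n M)
    {e e' : OpenPartialHomeomorph M (EuclideanSpace ℝ (Fin n))}
    (he : e ∈ atlas (EuclideanSpace ℝ (Fin n)) M) (he' : e' ∈ atlas (EuclideanSpace ℝ (Fin n)) M)
    {y : EuclideanSpace ℝ (Fin n)} (hy : y ∈ e.target) (hy' : e.symm y ∈ e'.source) :
    DifferentiableAt ℝ (e' ∘ e.symm) y ∧
    Real.sqrt |(g.gram e y).det| = |(fderiv ℝ (e' ∘ e.symm) y).det| *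
      Real.sqrt |(g.gram e' (e' (e.symm y))).det| := by
  have hd1 : MDifferentiableAt (𝓡 n) (𝓡 n) e.symm y := mdifferentiableAt_atlas_symm he hy
  have hd2 : MDifferentiableAt (𝓡 n) (𝓡 n) e' (e.symm y) := mdifferentiableAt_atlas he' hy'
  have hd : MDifferentiableAt (𝓡 n) (𝓡 n) (e' ∘ e.symm) y := hd2.comp y hd1
  have hd3 : MDifferentiableAt (𝓡 n) (𝓡 n) e'.symm ((e' ∘ e.symm) y) :=
    mdifferentiableAt_atlas_symm he' (e'.map_source hy')
  have hdiff : DifferentiableAt ℝ (e' ∘ e.symm) y := hd.differentiableAt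
  refine ⟨hdiff, ?_⟩
  have hev : e.symm =ᶠ[𝓝 y] e'.symm ∘ (e' ∘ e.symm) := by
    have : e.symm ⁻¹' e'.source ∈ 𝓝 y :=
      (e.continuousAt_symm hy).preimage_mem_nhds (e'.open_source.mem_nhds hy')
    filter_upwards [this] with z hz
    exact (e'.left_inv hz).symm
  set J : EuclideanSpace ℝ (Fin n) →L[ℝ] EuclideanSpace ℝ (Fin n) :=
    fderiv ℝ (e' ∘ e.symm) y with hJ
  set p := e'.symm ((e' ∘ e.symm) y) with hp
  have hpe : e.symm y = p := hev.self_of_nhds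
  set A : EuclideanSpace ℝ (Fin n) →L[ℝ] EuclideanSpace ℝ (Fin n) :=
    mfderiv (𝓡 n) (𝓡 n) e'.symm ((e' ∘ e.symm) y) with hA
  have hchain : (mfderiv (𝓡 n) (𝓡 n) e.symm y :
      EuclideanSpace ℝ (Fin n) →L[ℝ] EuclideanSpace ℝ (Fin n)) = A.comp J := by
    rw [hJ, ← mfderiv_eq_fderiv, hA]
    rw [hev.mfderiv_eq]
    exact mfderiv_comp y hd3 hd
  let b := (EuclideanSpace.basisFun (Fin n) ℝ).toBasis
  have hb : ∀ i, b i = EuclideanSpace.single i (1 : ℝ) := fun i ↦ by simp [b]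
  let Jm := LinearMap.toMatrix b b (J : EuclideanSpace ℝ (Fin n) →ₗ[ℝ] EuclideanSpace ℝ (Fin n))
  let B : EuclideanSpace ℝ (Fin n) →L[ℝ] EuclideanSpace ℝ (Fin n) →L[ℝ] ℝ := g.metric p
  let B' : LinearMap.BilinForm ℝ (EuclideanSpace ℝ (Fin n)) :=
    LinearMap.mk₂ ℝ (fun v w ↦ B (A v) (A w)) (by simp) (by simp) (by simp) (by simp)
  have hG' : g.gram e' ((e' ∘ e.symm) y) = LinearMap.BilinForm.toMatrix b B' := by
    ext i j
    simp only [gram, Matrix.of_apply, LinearMap.BilinForm.toMatrix_apply, hb]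
    rfl
  have key : ∀ (q : M) (_ : q = p) (v w : EuclideanSpace ℝ (Fin n)),
      (g.metric q : EuclideanSpace ℝ (Fin n) →L[ℝ] EuclideanSpace ℝ (Fin n) →L[ℝ] ℝ) v w
        = B v w := by
    rintro q rfl v w; rfl
  have hG : g.gram e y = LinearMap.BilinForm.toMatrix b
      (B'.comp (J : EuclideanSpace ℝ (Fin n) →ₗ[ℝ] EuclideanSpace ℝ (Fin n)) J) := by
    ext i j
    simp only [gram, Matrix.of_apply, LinearMap.BilinForm.toMatrix_apply, hb]
    refine (key _ hpe _ _).trans ?_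
    have h1 := fun v ↦ DFunLike.congr_fun hchain v
    exact congrArg₂ (fun v w ↦ B v w) (h1 _) (h1 _)
  have hdet : (g.gram e y).det = J.det ^ 2 * (g.gram e' ((e' ∘ e.symm) y)).det := by
    rw [hG, hG', LinearMap.BilinForm.toMatrix_comp b b, Matrix.det_mul, Matrix.det_mul,
      Matrix.det_transpose, LinearMap.det_toMatrix]
    change J.det * _ * J.det = _
    ring
  rw [hdet, abs_mul, Real.sqrt_mul (abs_nonneg _), abs_pow, Real.sqrt_sq (abs_nonneg _)]
  rfl

variable [MeasurableSpace M]

/-- The measure `√|det g_ij| dx¹ ⋯ dxⁿ` on the domain of the chart `e`. -/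
noncomputable def chartVolume (g : Spacetime n M)
    (e : OpenPartialHomeomorph M (EuclideanSpace ℝ (Fin n))) : Measure M :=
  Measure.map e.symm ((volume.restrict e.target).withDensity
    fun y ↦ ENNReal.ofReal (Real.sqrt |(g.gram e y).det|))

/-- The volume measure `vol_g`: the least measure that dominates `√|det g_ij| dx¹ ⋯ dxⁿ` in every
chart. By the change of variables formula these local measures agree on overlaps, so that `vol_g`
coincides with each of them on the domain of its chart: see `vol_apply`. -/
noncomputable def vol (g : Spacetime n M) : Measure M :=
  ⨆ e ∈ atlas (EuclideanSpace ℝ (Fin n)) M, g.chartVolume e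

lemma chartVolume_apply [BorelSpace M] (g : Spacetime n M)
    (e : OpenPartialHomeomorph M (EuclideanSpace ℝ (Fin n))) {s : Set M}
    (hs : MeasurableSet s) :
    g.chartVolume e s = ∫⁻ y in e '' (s ∩ e.source),
      ENNReal.ofReal (Real.sqrt |(g.gram e y).det|) := by
  have hm : AEMeasurable e.symm (volume.restrict e.target) :=
    e.continuousOn_symm.aemeasurable e.open_target.measurableSet
  have him : e '' (s ∩ e.source) = e.target ∩ e.symm ⁻¹' s := by
    rw [inter_comm, e.image_source_inter_eq']
  have hms : MeasurableSet (e.target ∩ e.symm ⁻¹' s) := by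
    have h := (continuousOn_iff_continuous_domRestrict.mp e.continuousOn_symm).measurable hs
    have h2 := e.open_target.measurableSet.subtype_image h
    convert h2 using 1
    ext y
    simp [and_comm]
  rw [chartVolume, Measure.map_apply_of_aemeasurable
    (hm.mono_ac (withDensity_absolutelyContinuous _ _)) hs, him]
  have h0 : ((volume.restrict e.target).withDensity
      fun y ↦ ENNReal.ofReal (Real.sqrt |(g.gram e y).det|)) e.targetᶜ = 0 :=
    withDensity_absolutelyContinuous _ _ (by
      rw [Measure.restrict_apply e.open_target.measurableSet.compl]; simp)
  rw [← measure_inter_add_sdiff (e.symm ⁻¹' s) e.open_target.measurableSet,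
    measure_mono_null (s := (e.symm ⁻¹' s) \ e.target) (fun y hy ↦ hy.2) h0, add_zero, inter_comm,
    withDensity_apply _ hms, Measure.restrict_restrict hms, inter_assoc,
    inter_comm _ e.target, ← inter_assoc, inter_self]

/-- The local volume measures agree on overlaps of charts. -/
lemma chartVolume_congr [BorelSpace M] (g : Spacetime n M)
    {e e' : OpenPartialHomeomorph M (EuclideanSpace ℝ (Fin n))}
    (he : e ∈ atlas (EuclideanSpace ℝ (Fin n)) M) (he' : e' ∈ atlas (EuclideanSpace ℝ (Fin n)) M)
    {s : Set M} (hs : MeasurableSet s) (hse : s ⊆ e.source) (hse' : s ⊆ e'.source) :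
    g.chartVolume e s = g.chartVolume e' s := by
  rw [g.chartVolume_apply e hs, g.chartVolume_apply e' hs, inter_eq_left.mpr hse,
    inter_eq_left.mpr hse']
  have hms : MeasurableSet (e '' s) := by
    have h := (continuousOn_iff_continuous_domRestrict.mp e.continuousOn_symm).measurable hs
    have h2 := e.open_target.measurableSet.subtype_image h
    rw [← inter_eq_right.mpr hse, e.image_source_inter_eq']
    convert h2 using 1
    ext y
    simp [and_comm]
  have himg : e' '' s = (e' ∘ e.symm) '' (e '' s) := by
    rw [← image_comp]
    refine image_congr fun x hx ↦ ?_
    simp [e.left_inv (hse hx)]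
  have hinj : InjOn (e' ∘ e.symm) (e '' s) := by
    rintro _ ⟨a, ha, rfl⟩ _ ⟨c, hc, rfl⟩ h
    simp only [Function.comp_apply, e.left_inv (hse ha), e.left_inv (hse hc)] at h
    rw [e'.injOn (hse' ha) (hse' hc) h]
  have hch : ∀ y ∈ e '' s, y ∈ e.target ∧ e.symm y ∈ e'.source := by
    rintro _ ⟨a, ha, rfl⟩
    exact ⟨e.map_source (hse ha), by rw [e.left_inv (hse ha)]; exact hse' ha⟩
  rw [himg, lintegral_image_eq_lintegral_abs_det_fderiv_mul volume hms
    (fun y hy ↦ (g.gram_change he he' (hch y hy).1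
      (hch y hy).2).1.hasFDerivAt.hasFDerivWithinAt) hinj]
  refine setLIntegral_congr_fun hms fun y hy ↦ ?_
  rw [(g.gram_change he he' (hch y hy).1 (hch y hy).2).2,
    ENNReal.ofReal_mul (abs_nonneg _)]
  rfl

/-- In every chart, the volume measure is `√|det g_ij| dx¹ ⋯ dxⁿ`. -/
lemma vol_apply [BorelSpace M] (g : Spacetime n M)
    {e : OpenPartialHomeomorph M (EuclideanSpace ℝ (Fin n))}
    (he : e ∈ atlas (EuclideanSpace ℝ (Fin n)) M) {s : Set M} (hs : MeasurableSet s)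
    (hse : s ⊆ e.source) :
    g.vol s = ∫⁻ y in e '' s, ENNReal.ofReal (Real.sqrt |(g.gram e y).det|) := by
  have happ := g.chartVolume_apply e hs
  rw [inter_eq_left.mpr hse] at happ
  rw [← happ]
  refine le_antisymm ?_ ((le_iSup₂ (f := fun e _ ↦ g.chartVolume e) e he) s)
  have hle : g.vol ≤ (g.chartVolume e).restrict e.source +
      (⊤ : Measure M).restrict e.sourceᶜ := by
    refine iSup₂_le fun e' he' ↦ Measure.le_iff.mpr fun t ht ↦ ?_
    have hes := e.open_source.measurableSet
    rw [Measure.add_apply, Measure.restrict_apply ht, Measure.restrict_apply ht,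
      ← measure_inter_add_sdiff t hes]
    refine add_le_add ?_ ?_
    · have hz : g.chartVolume e' (t ∩ e.source) =
          g.chartVolume e' (t ∩ e.source ∩ e'.source) := by
        rw [g.chartVolume_apply e' (ht.inter hes),
          g.chartVolume_apply e' ((ht.inter hes).inter e'.open_source.measurableSet),
          inter_assoc _ e'.source, inter_self]
      rw [hz, g.chartVolume_congr he' he ((ht.inter hes).inter e'.open_source.measurableSet)
        (fun x hx ↦ hx.2) (fun x hx ↦ hx.1.2)]
      exact measure_mono inter_subset_left
    · exact (le_top : g.chartVolume e' ≤ ⊤) _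
  refine (hle s).trans ?_
  rw [Measure.add_apply, Measure.restrict_apply hs, Measure.restrict_apply hs,
    ← sdiff_eq, sdiff_eq_empty.mpr hse, measure_empty, add_zero]
  exact measure_mono inter_subset_left

/-- The cosmological volume function `τ(x) = vol_g(I⁻(x))`. -/
noncomputable def cosmologicalVolume (g : Spacetime n M) (x : M) : ℝ≥0∞ := g.vol (g.chronPast x)

/-- Regularity of the cosmological volume function: it is finite, and tends to `0` along every
past-inextendible causal curve. -/
def HasRegularCosmologicalVolume (g : Spacetime n M) : Prop :=
  (∀ x : M, g.cosmologicalVolume x < ⊤) ∧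
  ∀ γ : ℝ → M, g.IsPastInextendible γ →
    Tendsto (fun t ↦ g.cosmologicalVolume (γ t)) atBot (𝓝 0)

end Spacetime

/-! The engine is `HasRegularCosmologicalVolume.exists_tendsto`: a past-directed causal sequence
whose chronological futures all lie in that of a single point `p` must converge. Otherwise, pushing
it slightly to the future turns it into a timelike chain, and concatenating the links gives a
past-inextendible causal curve. Regularity forces `τ → 0` along this curve, yet `τ` is monotone
under `≪` and stays above `τ(p)`, which is positive because `I⁻(p)` is open and nonempty.

The rest follows from this. The sequence `x, y, x, y, …` yields antisymmetry of `≤`. Given causal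
relations `x i ≤ w i` with `w i → y` and all `x i` in the causal future of `p`, limits of curves are
followed from `y` into the past, one chart at a time (`exists_nhds_limit_alternative`). Either the
limit of the `x i` is reached, or an endless past-directed sequence arises that keeps leaving
neighbourhoods and so cannot converge, which is excluded. This closure property,
`exists_tendsto_causal`, gives compact diamonds and, applied to shrinking sets `I⁺(a) ∩ I⁻(b)`,
strong causality.

The local input for Lipschitz curves is openness of `≪`, push-up, and limits of causal curves. It is
proved in charts where the light cones form a `LipschitzConeField`. Causality is encoded there by
the closed relation `Prec`, membership in the cone up to a quadratic error. It passes to pointwise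
limits and still determines derivatives. Tilting along the common timelike vector `T` makes causal
curves timelike. -/

namespace Spacetime

/-! ### The metric and the time orientation in coordinates. -/

section ChartMetric

variable {n : ℕ} {M : Type*} [TopologicalSpace M]
  [ChartedSpace (EuclideanSpace ℝ (Fin n)) M] [IsManifold (𝓡 n) ∞ M]

/-- The differential of the inverse of the preferred chart at `p`. -/
noncomputable def chartFrame (n : ℕ) {M : Type*} [TopologicalSpace M]
    [ChartedSpace (EuclideanSpace ℝ (Fin n)) M] (p : M) (x : EuclideanSpace ℝ (Fin n)) :
    EuclideanSpace ℝ (Fin n) →L[ℝ]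
      TangentSpace (𝓡 n) ((chartAt (EuclideanSpace ℝ (Fin n)) p).symm x) :=
  mfderiv (𝓡 n) (𝓡 n) (chartAt (EuclideanSpace ℝ (Fin n)) p).symm x

/-- The metric in the coordinates of the preferred chart at `p`. -/
noncomputable def coordMetric (g : Spacetime n M) (p : M) (x : EuclideanSpace ℝ (Fin n)) :
    EuclideanSpace ℝ (Fin n) →L[ℝ] EuclideanSpace ℝ (Fin n) →L[ℝ] ℝ :=
  ContinuousLinearMap.bilinearComp (E := EuclideanSpace ℝ (Fin n))
    (F := EuclideanSpace ℝ (Fin n))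
    (g.metric ((chartAt (EuclideanSpace ℝ (Fin n)) p).symm x))
    (chartFrame n p x) (chartFrame n p x)

lemma coordMetric_apply (g : Spacetime n M) (p : M) (x v w : EuclideanSpace ℝ (Fin n)) :
    g.coordMetric p x v w = g.metric ((chartAt (EuclideanSpace ℝ (Fin n)) p).symm x)
      (chartFrame n p x v) (chartFrame n p x w) := rfl

lemma coordMetric_symm (g : Spacetime n M) (p : M) (x v w : EuclideanSpace ℝ (Fin n)) :
    g.coordMetric p x v w = g.coordMetric p x w v := g.symm _ _ _

/-- Smoothness of the metric and continuity of the time field can be read off in the tangent bundle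
trivialization at `p`; this identification carries both over to coordinates. -/
lemma chartFrame_eq_symmL (p : M) {x : EuclideanSpace ℝ (Fin n)}
    (hx : x ∈ (chartAt (EuclideanSpace ℝ (Fin n)) p).target) :
    chartFrame n p x = (trivializationAt (EuclideanSpace ℝ (Fin n)) (TangentSpace (𝓡 n)) p).symmL ℝ
      ((chartAt (EuclideanSpace ℝ (Fin n)) p).symm x) := by
  rw [TangentBundle.symmL_trivializationAt
    ((chartAt (EuclideanSpace ℝ (Fin n)) p).map_target hx)]
  have hr : (chartAt (EuclideanSpace ℝ (Fin n)) p)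
      ((chartAt (EuclideanSpace ℝ (Fin n)) p).symm x) = x := OpenPartialHomeomorph.right_inv _ hx
  simp only [chartFrame, extChartAt, mfld_simps, mfderivWithin_univ]
  have key : ∀ y, y = x →
      (mfderiv (𝓡 n) (𝓡 n) (chartAt (EuclideanSpace ℝ (Fin n)) p).symm x :
        EuclideanSpace ℝ (Fin n) →L[ℝ] EuclideanSpace ℝ (Fin n)) =
      (mfderiv (𝓡 n) (𝓡 n) (chartAt (EuclideanSpace ℝ (Fin n)) p).symm y :
        EuclideanSpace ℝ (Fin n) →L[ℝ] EuclideanSpace ℝ (Fin n)) := by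
    rintro y rfl; rfl
  exact key _ hr

/-- The components of the metric are smooth. -/
lemma contDiffAt_coordMetric (g : Spacetime n M) (p : M) :
    ContDiffAt ℝ ∞ (g.coordMetric p) (chartAt (EuclideanSpace ℝ (Fin n)) p p) := by
  set φ := chartAt (EuclideanSpace ℝ (Fin n)) p with hφ
  have h := ((contMDiffAt_hom_bundle _).1 (g.contMDiff p)).2
  have hs : ContMDiffAt (𝓡 n) (𝓡 n) ∞ φ.symm (φ p) :=
    contMDiffOn_chart_symm.contMDiffAt (φ.open_target.mem_nhds (mem_chart_target _ p))
  have hp : φ.symm (φ p) = p := φ.left_inv (mem_chart_source _ p)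
  have h2 := ContMDiffAt.comp (φ p) (by rw [hp]; exact h) hs
  rw [← contMDiffAt_iff_contDiffAt]
  refine h2.congr_of_eventuallyEq ?_
  filter_upwards [φ.open_target.mem_nhds (mem_chart_target _ p)] with x hx
  have hxs : φ.symm x ∈ φ.source := φ.map_target hx
  ext1 v
  ext1 w
  simp only [Function.comp_apply]
  rw [inCoordinates_apply_eq₂ (by simpa using hxs) (by simpa using hxs)
    (by simp)]
  rw [coordMetric_apply, chartFrame_eq_symmL p hx]
  rw [Bundle.Trivialization.symmL_apply _ (by simpa using hxs),
    Bundle.Trivialization.symmL_apply _ (by simpa using hxs)]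
  simp
  rfl

/-- The time orientation in the coordinates of the preferred chart at `p`. -/
noncomputable def coordTimeField (g : Spacetime n M) (p : M) (x : EuclideanSpace ℝ (Fin n)) :
    EuclideanSpace ℝ (Fin n) :=
  mfderiv (𝓡 n) (𝓡 n) (chartAt (EuclideanSpace ℝ (Fin n)) p)
    ((chartAt (EuclideanSpace ℝ (Fin n)) p).symm x)
    (g.timeField ((chartAt (EuclideanSpace ℝ (Fin n)) p).symm x))

lemma chartFrame_mfderiv_chartAt (p : M) {x : EuclideanSpace ℝ (Fin n)}
    (hx : x ∈ (chartAt (EuclideanSpace ℝ (Fin n)) p).target)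
    (v : TangentSpace (𝓡 n) ((chartAt (EuclideanSpace ℝ (Fin n)) p).symm x)) :
    chartFrame n p x (mfderiv (𝓡 n) (𝓡 n) (chartAt (EuclideanSpace ℝ (Fin n)) p)
      ((chartAt (EuclideanSpace ℝ (Fin n)) p).symm x) v) = v := by
  have hxs := (chartAt (EuclideanSpace ℝ (Fin n)) p).map_target hx
  have h := TangentBundle.continuousLinearMapAt_trivializationAt (I := 𝓡 n) (x₀ := p) hxs
  simp only [extChartAt, mfld_simps] at h
  rw [chartFrame_eq_symmL p hx, ← h]
  exact Bundle.Trivialization.symmL_continuousLinearMapAt _ (by simpa using hxs) v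

lemma mfderiv_chartAt_chartFrame (p : M) {x : EuclideanSpace ℝ (Fin n)}
    (hx : x ∈ (chartAt (EuclideanSpace ℝ (Fin n)) p).target) (v : EuclideanSpace ℝ (Fin n)) :
    (mfderiv (𝓡 n) (𝓡 n) (chartAt (EuclideanSpace ℝ (Fin n)) p)
      ((chartAt (EuclideanSpace ℝ (Fin n)) p).symm x) (chartFrame n p x v)) = v := by
  set φ := chartAt (EuclideanSpace ℝ (Fin n)) p with hφ
  have hxs : φ.symm x ∈ φ.source := φ.map_target hx
  have h := TangentBundle.continuousLinearMapAt_trivializationAt (I := 𝓡 n) (x₀ := p) hxs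
  simp only [extChartAt, mfld_simps] at h
  rw [← hφ] at h
  rw [chartFrame_eq_symmL p hx, ← h]
  exact Bundle.Trivialization.continuousLinearMapAt_symmL _ (by simpa using hxs) v

lemma chartFrame_coordTimeField (g : Spacetime n M) (p : M) {x : EuclideanSpace ℝ (Fin n)}
    (hx : x ∈ (chartAt (EuclideanSpace ℝ (Fin n)) p).target) :
    chartFrame n p x (g.coordTimeField p x) =
      g.timeField ((chartAt (EuclideanSpace ℝ (Fin n)) p).symm x) :=
  chartFrame_mfderiv_chartAt p hx _

lemma continuousAt_coordTimeField (g : Spacetime n M) (p : M) :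
    ContinuousAt (g.coordTimeField p) (chartAt (EuclideanSpace ℝ (Fin n)) p p) := by
  set φ := chartAt (EuclideanSpace ℝ (Fin n)) p with hφ
  have h := ((FiberBundle.continuousAt_totalSpace _ _).1
    (g.continuous_timeField.continuousAt (x := p))).2
  have hp : φ.symm (φ p) = p := φ.left_inv (mem_chart_source _ p)
  have hs : ContinuousAt φ.symm (φ p) := φ.continuousAt_symm (mem_chart_target _ p)
  have h2 := ContinuousAt.comp (x := φ p) (by rw [hp]; exact h) hs
  refine h2.congr ?_
  filter_upwards [φ.open_target.mem_nhds (mem_chart_target _ p)] with x hx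
  have hxs : φ.symm x ∈ φ.source := φ.map_target hx
  have h := TangentBundle.continuousLinearMapAt_trivializationAt (I := 𝓡 n) (x₀ := p) hxs
  simp only [extChartAt, mfld_simps] at h
  rw [← hφ] at h
  rw [coordTimeField, ← hφ, ← h]
  refine Eq.symm ((congrFun (Bundle.Trivialization.continuousLinearMapAt_apply ℝ _ _) _).trans ?_)
  rw [Bundle.Trivialization.linearMapAt_apply, if_pos (by simpa using hxs)]
  rfl

end ChartMetric

end Spacetime

/-! ### Lipschitz cone fields and their existence near a point. -/

/-- A Lipschitz field of closed convex cones on a subset `K` of a normed space, uniformly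
transversal to the level sets of a linear functional `ℓ` and containing a fixed vector `T` in
their interiors. -/
structure LipschitzConeField {E : Type*} [NormedAddCommGroup E] [NormedSpace ℝ E] (K : Set E) where
  /-- The closed cones. -/
  causal : E → Set E
  /-- The open cones. -/
  timelike : E → Set E
  /-- The common interior vector. -/
  T : E
  /-- The common positive functional. -/
  ℓ : E →L[ℝ] ℝ
  /-- The bound of the norm by the functional on the cones. -/
  C : ℝ
  /-- The Lipschitz constant. -/
  L : ℝ
  C_nonneg : 0 ≤ C
  L_nonneg : 0 ≤ L
  apply_T : ℓ T = 1
  zero_mem : ∀ {x}, x ∈ K → (0 : E) ∈ causal x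
  add_mem : ∀ {x v w}, x ∈ K → v ∈ causal x → w ∈ causal x → v + w ∈ causal x
  smul_mem : ∀ {x v} {a : ℝ}, x ∈ K → 0 ≤ a → v ∈ causal x → a • v ∈ causal x
  smul_mem_timelike : ∀ {x v} {a : ℝ}, x ∈ K → 0 < a → v ∈ timelike x → a • v ∈ timelike x
  norm_le : ∀ {x v}, x ∈ K → v ∈ causal x → ‖v‖ ≤ C * ℓ v
  add_smul_T_mem : ∀ {x v} {a : ℝ}, x ∈ K → v ∈ causal x → 0 < a → v + a • T ∈ timelike x
  timelike_subset : ∀ {x v}, x ∈ K → v ∈ timelike x → v ∈ causal x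
  isClosed_causal : IsClosed {p : E × E | p.1 ∈ K ∧ p.2 ∈ causal p.1}
  eventually_timelike : ∀ {x v}, x ∈ K → v ∈ timelike x →
    ∀ᶠ p in 𝓝 (x, v), p.1 ∈ K → p.2 ∈ timelike p.1
  -- Lipschitz dependence on the point: moving the base point costs a multiple of `T` proportional
  -- to the distance.
  tilt_mem : ∀ {x y v}, x ∈ K → y ∈ K → v ∈ causal y → v + (L * ‖x - y‖ * ℓ v) • T ∈ causal x
  -- The domain is so small that tilting a curve along `T` gains more than the resulting
  -- displacement costs through `tilt_mem`.
  small : ∀ {x y}, x ∈ K → y ∈ K → L * ‖T‖ * ℓ (y - x) < 1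

section Existence

variable {E : Type*} [NormedAddCommGroup E] [NormedSpace ℝ E]

/-- The constant is the minimum of `h` on the compact unit sphere. If the sphere is empty, the space
is trivial and any constant works. -/
lemma exists_pos_mul_sq_norm_le [FiniteDimensional ℝ E] (h : E → ℝ) (hc : Continuous h)
    (hpos : ∀ v ≠ 0, 0 < h v) (hhom : ∀ (a : ℝ) v, h (a • v) = a ^ 2 * h v) :
    ∃ c > 0, ∀ v, c * ‖v‖ ^ 2 ≤ h v := by
  by_cases hne : (Metric.sphere (0 : E) 1).Nonempty
  · obtain ⟨u, hu, hmin⟩ := (isCompact_sphere (0 : E) 1).exists_isMinOn hne hc.continuousOn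
    have hu0 : u ≠ 0 := by
      rintro rfl; simp at hu
    refine ⟨h u, hpos u hu0, fun v ↦ ?_⟩
    by_cases hv : v = 0
    · subst hv
      have := hhom 0 (0 : E)
      simp at this
      simp [this]
    have hv' : 0 < ‖v‖ := norm_pos_iff.2 hv
    have h1 : h u ≤ h (‖v‖⁻¹ • v) := hmin (by
      simp [norm_smul, hv'.ne'])
    rw [hhom] at h1
    have : ‖v‖⁻¹ ^ 2 * h v * ‖v‖ ^ 2 = h v := by field_simp
    nlinarith [sq_nonneg ‖v‖]
  · refine ⟨1, one_pos, fun v ↦ ?_⟩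
    have hv : v = 0 := by
      by_contra hv
      exact hne ⟨‖v‖⁻¹ • v, by simp [norm_smul, (norm_pos_iff.2 hv).ne']⟩
    subst hv
    have := hhom 0 (0 : E)
    simp at this
    simp [this]

/-- A reversed Cauchy–Schwarz inequality. -/
lemma apply_le_of_nonneg_ker {B : E →L[ℝ] E →L[ℝ] ℝ} (hB : ∀ v w, B v w = B w v) {ℓ : E →L[ℝ] ℝ}
    (hker : ∀ u, ℓ u = 0 → 0 ≤ B u u) (v w : E) :
    2 * (ℓ v * ℓ w * B v w) ≤ ℓ w ^ 2 * B v v + ℓ v ^ 2 * B w w := by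
  -- This combination of `v` and `w` is killed by `ℓ`.
  have h := hker (ℓ w • v - ℓ v • w) (by simp [mul_comm])
  simp only [map_sub, map_smul, sub_apply, smul_apply,
    smul_eq_mul, hB w v] at h
  linarith

set_option maxHeartbeats 1000000 in
-- At `x₀` the complement of `T` is positive definite, so `G x₀ + 2βℓ²`, with `ℓ` the normalized
-- dual form of `T`, is positive definite. As long as `G` varies by less than half the lower bound
-- of this form, `ℓ` controls the norm of causal vectors, `ker ℓ` remains spacelike, and the sign of
-- `ℓ` separates the two half cones.
theorem exists_uniform_transversality [FiniteDimensional ℝ E] {G : E → E →L[ℝ] E →L[ℝ] ℝ}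
    {X : E → E} {x₀ : E} (hsymm : ∀ x v w, G x v w = G x w v) (hG : ContDiffAt ℝ 1 G x₀)
    (hX : ContinuousAt X x₀) (hneg : G x₀ (X x₀) (X x₀) < 0)
    (hsig : ∃ v, G x₀ v v < 0 ∧ ∀ w, G x₀ v w = 0 → w ≠ 0 → 0 < G x₀ w w) :
    ∃ (T : E) (ℓ : E →L[ℝ] ℝ) (C β : ℝ) (κ : NNReal) (s : Set E), s ∈ 𝓝 x₀ ∧ LipschitzOnWith κ G s ∧
      0 ≤ C ∧ 0 < β ∧ ℓ T = 1 ∧ ∀ x ∈ s, G x T T < 0 ∧ (∀ v, G x v v ≤ 0 → ‖v‖ ≤ C * |ℓ v|) ∧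
        (∀ v, 0 ≤ ℓ v → ‖v‖ ≤ C * ℓ v → G x T v ≤ -(β / 2) * ℓ v) ∧
        (∀ v, G x v v ≤ 0 → (G x (X x) v < 0 ↔ 0 < ℓ v)) := by
  -- `X x₀` is not orthogonal to `T`, whose complement is positive; the sign of `T` is chosen to put
  -- both into the same half cone.
  obtain ⟨T, hT, hTpos, hXT⟩ : ∃ T, G x₀ T T < 0 ∧
      (∀ w, G x₀ T w = 0 → w ≠ 0 → 0 < G x₀ w w) ∧ G x₀ T (X x₀) < 0 := by
    obtain ⟨v, hv, hpos⟩ := hsig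
    rcases lt_trichotomy (G x₀ v (X x₀)) 0 with h | h | h
    · exact ⟨v, hv, hpos, h⟩
    · have hX0 : X x₀ ≠ 0 := by
        intro h0; simp [h0] at hneg
      exact absurd (hpos _ h hX0) hneg.not_gt
    · exact ⟨-v, by simpa using hv, fun w hw ↦ hpos w (by simpa using hw), by simpa using h⟩
  obtain ⟨β, hβdef⟩ : ∃ β, β = -G x₀ T T := ⟨_, rfl⟩
  have hβ : 0 < β := by simp [hβdef, hT]
  obtain ⟨ℓ, hℓdef⟩ : ∃ ℓ : E →L[ℝ] ℝ, ℓ = (-β⁻¹) • G x₀ T := ⟨_, rfl⟩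
  have hℓ : ∀ v, G x₀ T v = -β * ℓ v := fun v ↦ by
    simp only [hℓdef, smul_apply, smul_eq_mul]; field_simp
  have hℓT : ℓ T = 1 := by
    have h := hℓ T
    have h2 : -β = -β * ℓ T := by rw [← h]; simp [hβdef]
    nlinarith
  -- Writing `v = ℓ v • T + u` with `u` orthogonal to `T` turns the form into `β(ℓ v)² + G x₀ u u`.
  obtain ⟨c, hc, hcle⟩ := exists_pos_mul_sq_norm_le (fun v ↦ G x₀ v v + 2 * β * ℓ v ^ 2)
    (by fun_prop) (fun v hv ↦ by
      have h1 : G x₀ T (v - ℓ v • T) = 0 := by rw [hℓ]; simp [hℓT]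
      have h2 : G x₀ v v = -β * ℓ v ^ 2 + G x₀ (v - ℓ v • T) (v - ℓ v • T) := by
        have e1 := hℓ v
        have e2 := hsymm x₀ v T
        have e3 : G x₀ T T = -β := by simp [hβdef]
        simp only [map_sub, map_smul, sub_apply,
          smul_apply, smul_eq_mul, e2, e1, e3]
        ring
      by_cases hu : v - ℓ v • T = 0
      · have hl : ℓ v ≠ 0 := by
          intro h; rw [h] at hu; simp at hu; exact hv hu
        rw [hu] at h2
        simp only [map_zero, add_zero] at h2
        have : 0 < ℓ v ^ 2 := by positivity
        nlinarith
      · have := hTpos _ h1 hu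
        nlinarith [sq_nonneg (ℓ v)]) (fun a v ↦ by
      simp only [map_smul, smul_apply, smul_eq_mul]; ring)
  obtain ⟨κ, s, hs, hκ⟩ := hG.exists_lipschitzOnWith
  -- If `G x v v ≤ 0`, then `c‖v‖² ≤ G x₀ v v + 2β(ℓ v)² ≤ (c/2)‖v‖² + 2β(ℓ v)²`, which gives this
  -- constant.
  obtain ⟨C, hC⟩ : ∃ C, C = Real.sqrt (4 * β / c) := ⟨_, rfl⟩
  have hC2 : C ^ 2 = 4 * β / c := by rw [hC]; exact Real.sq_sqrt (by positivity)
  have hC0 : 0 ≤ C := hC ▸ Real.sqrt_nonneg _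
  have hGc : ContinuousAt G x₀ := hG.continuousAt
  have hGn : Tendsto (fun x ↦ ‖G x - G x₀‖) (𝓝 x₀) (𝓝 0) := by
    have h0 : Tendsto (fun x ↦ κ * ‖x - x₀‖) (𝓝 x₀) (𝓝 0) := by
      have : Tendsto (fun x ↦ κ * ‖x - x₀‖) (𝓝 x₀) (𝓝 (κ * ‖x₀ - x₀‖)) :=
        ((continuous_id.sub continuous_const).norm.const_mul _).tendsto _
      simpa using this
    refine squeeze_zero' (Eventually.of_forall fun x ↦ ContinuousLinearMap.opNorm_nonneg _) ?_ h0
    filter_upwards [hs] with x hx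
    simpa [dist_eq_norm] using hκ.dist_le_mul x hx x₀ (mem_of_mem_nhds hs)
  have ev1 : ∀ᶠ x in 𝓝 x₀, ‖G x - G x₀‖ < c / 2 := by
    exact hGn.eventually_lt_const (half_pos hc)
  have ev2 : ∀ᶠ x in 𝓝 x₀, ‖G x - G x₀‖ * (‖T‖ * C) < β / 2 := by
    have := hGn.mul_const (‖T‖ * C)
    rw [zero_mul] at this
    exact this.eventually_lt_const (half_pos hβ)
  have ev3 : ∀ᶠ x in 𝓝 x₀, G x T T < 0 := by
    have : Tendsto (fun x ↦ G x T T) (𝓝 x₀) (𝓝 (G x₀ T T)) :=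
      (hGc.clm_apply continuousAt_const).clm_apply continuousAt_const
    exact this.eventually_lt_const hT
  have ev4 : ∀ᶠ x in 𝓝 x₀, G x (X x) (X x) < 0 := by
    have : Tendsto (fun x ↦ G x (X x) (X x)) (𝓝 x₀) (𝓝 (G x₀ (X x₀) (X x₀))) :=
      (hGc.clm_apply hX).clm_apply hX
    exact this.eventually_lt_const hneg
  have ev5 : ∀ᶠ x in 𝓝 x₀, 0 < ℓ (X x) := by
    have : Tendsto (fun x ↦ ℓ (X x)) (𝓝 x₀) (𝓝 (ℓ (X x₀))) :=
      ℓ.continuous.continuousAt.comp hX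
    refine this.eventually_const_lt ?_
    have := hℓ (X x₀)
    nlinarith
  set K := {x | ((((‖G x - G x₀‖ < c / 2 ∧ ‖G x - G x₀‖ * (‖T‖ * C) < β / 2) ∧ G x T T < 0) ∧
    G x (X x) (X x) < 0) ∧ 0 < ℓ (X x)) ∧ x ∈ s} with hK
  have hKn : K ∈ 𝓝 x₀ := ((((ev1.and ev2).and ev3).and ev4).and ev5).and hs
  have habs : ∀ x v w, |G x v w - G x₀ v w| ≤ ‖G x - G x₀‖ * ‖v‖ * ‖w‖ := fun x v w ↦ by
    have := (G x - G x₀).le_opNorm₂ v w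
    simpa using this
  have hnorm : ∀ {x v}, x ∈ K → G x v v ≤ 0 → ‖v‖ ≤ C * |ℓ v| := by
    intro x v hx hv
    have h1 : ‖G x - G x₀‖ < c / 2 := hx.1.1.1.1.1
    have h2 := hcle v
    have h3 := abs_le.1 (habs x v v)
    have h4 : c / 2 * ‖v‖ ^ 2 ≤ 2 * β * ℓ v ^ 2 := by
      nlinarith [sq_nonneg ‖v‖]
    refine abs_le_of_sq_le_sq (a := ‖v‖) ?_ (by positivity) |> (le_abs_self _).trans
    rw [mul_pow, hC2, sq_abs]
    rw [div_mul_eq_mul_div, le_div_iff₀ hc]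
    linarith
  have hker : ∀ {x}, x ∈ K → ∀ u, ℓ u = 0 → 0 ≤ G x u u := by
    intro x hx u hu
    by_contra! h
    have := hnorm hx h.le
    rw [hu] at this
    have hu0 : u = 0 := by simpa using this
    simp [hu0] at h
  have hTb : ∀ {x v}, x ∈ K → 0 ≤ ℓ v → ‖v‖ ≤ C * ℓ v → G x T v ≤ -(β / 2) * ℓ v := by
    intro x v hx hv0 hv
    have h1 := hx.1.1.1.1.2
    have h2 := (abs_le.1 (habs x T v)).2
    have h3 : ‖G x - G x₀‖ * ‖T‖ * ‖v‖ ≤ β / 2 * ℓ v := by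
      calc ‖G x - G x₀‖ * ‖T‖ * ‖v‖ ≤ ‖G x - G x₀‖ * ‖T‖ * (C * ℓ v) := by gcongr
        _ = ‖G x - G x₀‖ * (‖T‖ * C) * ℓ v := by ring
        _ ≤ _ := by gcongr
    rw [hℓ] at h2
    linarith
  have hsign : ∀ {x v}, x ∈ K → G x v v ≤ 0 → (G x (X x) v < 0 ↔ 0 < ℓ v) := by
    intro x v hx hv
    have hXx : G x (X x) (X x) < 0 := hx.1.1.2
    have hlX : 0 < ℓ (X x) := hx.1.2
    have h := apply_le_of_nonneg_ker (hsymm x) (hker hx) (X x) v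
    have hvs : ℓ (X x) ^ 2 * G x v v ≤ 0 := mul_nonpos_of_nonneg_of_nonpos (sq_nonneg _) hv
    rcases eq_or_ne (ℓ v) 0 with h0 | h0
    · have hv0 : v = 0 := by
        have := hnorm hx hv
        rw [h0] at this
        simpa using this
      simp [hv0]
    · have hlt : ℓ v ^ 2 * G x (X x) (X x) < 0 := mul_neg_of_pos_of_neg (by positivity) hXx
      have h2 : ℓ (X x) * (ℓ v * G x (X x) v) < 0 := by nlinarith
      have h3 : ℓ v * G x (X x) v < 0 := by
        by_contra! h4
        exact absurd (mul_nonneg hlX.le h4) h2.not_ge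
      constructor
      · intro h4
        by_contra! h5
        exact absurd (mul_nonneg_of_nonpos_of_nonpos h5 h4.le) h3.not_ge
      · intro h4
        by_contra! h5
        exact absurd (mul_nonneg h4.le h5) h3.not_ge
  exact ⟨T, ℓ, C, β, κ, K, hKn, hκ.mono fun x hx ↦ hx.2, hC0, hβ, hℓT, fun x hx ↦ ⟨hx.1.1.1.2,
    fun v ↦ hnorm hx, fun v ↦ hTb hx, fun v ↦ hsign hx⟩⟩

/-- The half cones are cut out by the constant form `ℓ` instead of `X`, so continuity of `X`
suffices and only `G` has to be Lipschitz. Convexity of the cones is the reversed Cauchy–Schwarz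
inequality. -/
theorem exists_lipschitzConeField [FiniteDimensional ℝ E] {G : E → E →L[ℝ] E →L[ℝ] ℝ} {X : E → E}
    {x₀ : E} (hsymm : ∀ x v w, G x v w = G x w v) (hG : ContDiffAt ℝ 1 G x₀)
    (hX : ContinuousAt X x₀) (hneg : G x₀ (X x₀) (X x₀) < 0)
    (hsig : ∃ v, G x₀ v v < 0 ∧ ∀ w, G x₀ v w = 0 → w ≠ 0 → 0 < G x₀ w w)
    {W : Set E} (hW : W ∈ 𝓝 x₀) :
    ∃ r > 0, Metric.closedBall x₀ r ⊆ W ∧ ∃ F : LipschitzConeField (Metric.closedBall x₀ r),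
      ∀ x ∈ Metric.closedBall x₀ r, ∀ v,
        (v ∈ F.causal x ∧ v ≠ 0 ↔ G x v v ≤ 0 ∧ G x (X x) v < 0) ∧
        (v ∈ F.timelike x ↔ G x v v < 0 ∧ G x (X x) v < 0) := by
  obtain ⟨T, ℓ, C, β, κ, s, hs, hκ, hC0, hβ, hℓT, hall⟩ :=
    exists_uniform_transversality hsymm hG hX hneg hsig
  -- Adding `a • T` with `a = L‖x - y‖ ℓ v` lowers the form by at least `aβ ℓ v`; this equals the
  -- bound `κ‖x - y‖(C ℓ v)²` for the change from `G y` to `G x`.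
  set L := κ * C ^ 2 / β with hL
  have hL0 : 0 ≤ L := by positivity
  obtain ⟨r₁, hr₁, hball⟩ := Metric.nhds_basis_closedBall.mem_iff.1 (inter_mem hs hW)
  -- Two points of the ball differ by at most `2r`, so this radius yields the field `small`.
  set r := min r₁ (1 / (4 * (L * ‖T‖ * ‖ℓ‖ + 1))) with hr
  have hr0 : 0 < r := by positivity
  have hsub : Metric.closedBall x₀ r ⊆ Metric.closedBall x₀ r₁ :=
    Metric.closedBall_subset_closedBall (min_le_left _ _)
  set K := Metric.closedBall x₀ r with hK
  have hKs : K ⊆ s := fun x hx ↦ (hball (hsub hx)).1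
  have hGK : ContinuousOn G K := (hκ.mono hKs).continuousOn
  have hnorm : ∀ {x v}, x ∈ K → G x v v ≤ 0 → ‖v‖ ≤ C * |ℓ v| :=
    fun {x v} hx ↦ (hall x (hKs hx)).2.1 v
  have hTb : ∀ {x v}, x ∈ K → 0 ≤ ℓ v → ‖v‖ ≤ C * ℓ v → G x T v ≤ -(β / 2) * ℓ v :=
    fun {x v} hx ↦ (hall x (hKs hx)).2.2.1 v
  have hsign : ∀ {x v}, x ∈ K → G x v v ≤ 0 → (G x (X x) v < 0 ↔ 0 < ℓ v) :=
    fun {x v} hx ↦ (hall x (hKs hx)).2.2.2 v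
  have hker : ∀ {x}, x ∈ K → ∀ u, ℓ u = 0 → 0 ≤ G x u u := by
    intro x hx u hu
    by_contra! h
    have := hnorm hx h.le
    rw [hu] at this
    have hu0 : u = 0 := by simpa using this
    simp [hu0] at h
  have hexp : ∀ x v (a : ℝ), G x (v + a • T) (v + a • T) =
      G x v v + 2 * a * G x T v + a ^ 2 * G x T T := by
    intro x v a
    simp only [map_add, map_smul, add_apply, smul_apply,
      smul_eq_mul, hsymm x v T]
    ring
  have hnorm' : ∀ {x v}, x ∈ K → G x v v ≤ 0 → 0 ≤ ℓ v → ‖v‖ ≤ C * ℓ v := by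
    intro x v hx h h0
    simpa [abs_of_nonneg h0] using hnorm hx h
  refine ⟨r, hr0, fun x hx ↦ (hball (hsub hx)).2,
    { causal := fun x ↦ {v | G x v v ≤ 0 ∧ 0 ≤ ℓ v}
      timelike := fun x ↦ {v | G x v v < 0 ∧ 0 < ℓ v}
      T := T
      ℓ := ℓ
      C := C
      L := L
      C_nonneg := hC0
      L_nonneg := hL0
      apply_T := hℓT
      zero_mem := fun _ ↦ by simp
      add_mem := ?_
      smul_mem := ?_
      smul_mem_timelike := ?_
      norm_le := fun hx hv ↦ hnorm' hx hv.1 hv.2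
      add_smul_T_mem := ?_
      timelike_subset := fun _ hv ↦ ⟨hv.1.le, hv.2.le⟩
      isClosed_causal := ?_
      eventually_timelike := ?_
      tilt_mem := ?_
      small := ?_ }, ?_⟩
  · rintro x v w hx ⟨hv, hv0⟩ ⟨hw, hw0⟩
    refine ⟨?_, by simpa using add_nonneg hv0 hw0⟩
    have h := apply_le_of_nonneg_ker (hsymm x) (hker hx) v w
    have e : G x (v + w) (v + w) = G x v v + 2 * G x v w + G x w w := by
      simp only [map_add, add_apply, hsymm x w v]; ring
    rcases hv0.eq_or_lt with h0 | h0
    · have hv' := hnorm' hx hv hv0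
      rw [← h0] at hv'
      have : v = 0 := by simpa using hv'
      simpa [this] using hw
    rcases hw0.eq_or_lt with h1 | h1
    · have hw' := hnorm' hx hw hw0
      rw [← h1] at hw'
      have : w = 0 := by simpa using hw'
      simpa [this] using hv
    have h2 : G x v w ≤ 0 := by
      by_contra! h3
      have h4 : 0 < ℓ v * ℓ w * G x v w := by positivity
      nlinarith [mul_nonpos_of_nonneg_of_nonpos (sq_nonneg (ℓ w)) hv,
        mul_nonpos_of_nonneg_of_nonpos (sq_nonneg (ℓ v)) hw]
    rw [e]; linarith
  · rintro x v a hx ha ⟨hv, hv0⟩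
    refine ⟨?_, by simpa using mul_nonneg ha hv0⟩
    simp only [map_smul, smul_apply, smul_eq_mul]
    nlinarith [mul_nonneg ha ha]
  · rintro x v a hx ha ⟨hv, hv0⟩
    refine ⟨?_, by simpa using mul_pos ha hv0⟩
    simp only [map_smul, smul_apply, smul_eq_mul]
    nlinarith [mul_pos ha ha]
  · rintro x v a hx ⟨hv, hv0⟩ ha
    have h1 := hTb hx hv0 (hnorm' hx hv hv0)
    have h2 : G x T T < 0 := (hall x (hKs hx)).1
    refine ⟨?_, by rw [map_add, map_smul, hℓT, smul_eq_mul]; linarith⟩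
    rw [hexp]
    have h3 : G x T v ≤ 0 := h1.trans (by nlinarith)
    nlinarith [mul_pos ha ha]
  · have h1 : IsClosed {p : E × E | p.1 ∈ K} := Metric.isClosed_closedBall.preimage continuous_fst
    have h2 : ContinuousOn (fun p : E × E ↦ G p.1 p.2 p.2) {p : E × E | p.1 ∈ K} :=
      ((hGK.comp continuousOn_fst fun p hp ↦ hp).clm_apply continuousOn_snd).clm_apply
        continuousOn_snd
    have h3 := h2.preimage_isClosed_of_isClosed h1 (isClosed_Iic (a := (0 : ℝ)))
    have h4 : IsClosed {p : E × E | 0 ≤ ℓ p.2} :=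
      isClosed_le continuous_const (ℓ.continuous.comp continuous_snd)
    convert h3.inter h4 using 1
    ext p
    simp [and_assoc, hK]
  · rintro x v hx ⟨hv, hv0⟩
    have h2 : ContinuousWithinAt (fun p : E × E ↦ G p.1 p.2 p.2) {p : E × E | p.1 ∈ K} (x, v) :=
      (((hGK.comp continuousOn_fst fun p hp ↦ hp).clm_apply continuousOn_snd).clm_apply
        continuousOn_snd) (x, v) hx
    have h3 := eventually_nhdsWithin_iff.1 (h2.eventually_lt_const hv)
    have h4 : ∀ᶠ p : E × E in 𝓝 (x, v), 0 < ℓ p.2 :=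
      (ℓ.continuous.comp continuous_snd).continuousAt.eventually_const_lt (by simpa using hv0)
    filter_upwards [h3, h4] with p h5 h6 h7 using ⟨h5 h7, h6⟩
  · rintro x y v hx hy ⟨hv, hv0⟩
    have hn := hnorm' hy hv hv0
    have h1 := hTb hx hv0 hn
    have h2 : G x T T < 0 := (hall x (hKs hx)).1
    have hlip : ‖G x - G y‖ ≤ κ * ‖x - y‖ := by
      simpa [dist_eq_norm] using hκ.dist_le_mul x (hKs hx) y (hKs hy)
    have h3 : G x v v - G y v v ≤ κ * ‖x - y‖ * (C * ℓ v) ^ 2 := by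
      have h := (le_abs_self _).trans ((G x - G y).le_opNorm₂ v v)
      simp only [sub_apply] at h
      calc _ ≤ _ := h
        _ ≤ κ * ‖x - y‖ * (C * ℓ v) * (C * ℓ v) := by gcongr
        _ = _ := by ring
    set a := L * ‖x - y‖ * ℓ v with ha
    have ha0 : 0 ≤ a := by positivity
    refine ⟨?_, by rw [map_add, map_smul, hℓT, smul_eq_mul]; linarith⟩
    rw [hexp]
    have h4 : 2 * a * G x T v ≤ 2 * a * (-(β / 2) * ℓ v) := by gcongr
    have h5 : a ^ 2 * G x T T ≤ 0 := mul_nonpos_of_nonneg_of_nonpos (sq_nonneg _) h2.le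
    have h6 : 2 * a * (-(β / 2) * ℓ v) = -(κ * ‖x - y‖ * (C * ℓ v) ^ 2) := by
      rw [ha, hL]; field_simp
    linarith
  · intro x y hx hy
    have h1 : ‖y - x‖ ≤ 2 * r := by
      have h2 := mem_closedBall_iff_norm.1 hx
      have h3 := mem_closedBall_iff_norm.1 hy
      calc ‖y - x‖ = ‖(y - x₀) - (x - x₀)‖ := by congr 1; abel
        _ ≤ _ := (norm_sub_le _ _).trans (by linarith)
    have h2 : ℓ (y - x) ≤ ‖ℓ‖ * (2 * r) :=
      (le_abs_self _).trans ((ℓ.le_opNorm _).trans (by gcongr))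
    set a := L * ‖T‖ * ‖ℓ‖ with ha
    have ha0 : 0 ≤ a := by positivity
    have h3 : r ≤ 1 / (4 * (a + 1)) := min_le_right _ _
    rw [le_div_iff₀ (by positivity)] at h3
    calc L * ‖T‖ * ℓ (y - x) ≤ L * ‖T‖ * (‖ℓ‖ * (2 * r)) := by gcongr
      _ = 2 * (a * r) := by rw [ha]; ring
      _ < 1 := by nlinarith
  · intro x hx v
    refine ⟨⟨?_, ?_⟩, ⟨?_, ?_⟩⟩
    · rintro ⟨⟨hv, hv0⟩, hne⟩
      refine ⟨hv, (hsign hx hv).2 (hv0.lt_of_ne ?_)⟩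
      intro h
      have := hnorm hx hv
      rw [← h] at this
      exact hne (by simpa using this)
    · rintro ⟨hv, hv0⟩
      refine ⟨⟨hv, ((hsign hx hv).1 hv0).le⟩, ?_⟩
      rintro rfl
      simp at hv0
    · rintro ⟨hv, hv0⟩
      exact ⟨hv, (hsign hx hv.le).2 hv0⟩
    · rintro ⟨hv, hv0⟩
      exact ⟨hv, (hsign hx hv.le).1 hv0⟩

end Existence

/-! ### The light cones of `g` in a chart. -/

namespace Spacetime

variable {n : ℕ} {M : Type*} [TopologicalSpace M]
  [ChartedSpace (EuclideanSpace ℝ (Fin n)) M] [IsManifold (𝓡 n) ∞ M]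

lemma coordMetric_signature (g : Spacetime n M) (p : M) :
    ∃ v, g.coordMetric p (chartAt (EuclideanSpace ℝ (Fin n)) p p) v v < 0 ∧
      ∀ w, g.coordMetric p (chartAt (EuclideanSpace ℝ (Fin n)) p p) v w = 0 → w ≠ 0 →
        0 < g.coordMetric p (chartAt (EuclideanSpace ℝ (Fin n)) p p) w w := by
  set φ := chartAt (EuclideanSpace ℝ (Fin n)) p with hφ
  have hx₀ : φ p ∈ φ.target := mem_chart_target _ p
  obtain ⟨v, hv, hpos⟩ := g.signature (φ.symm (φ p))
  refine ⟨mfderiv (𝓡 n) (𝓡 n) φ (φ.symm (φ p)) v, ?_, fun w hw hw0 ↦ ?_⟩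
  · refine (congrArg₂ (fun a b ↦ g.metric (φ.symm (φ p)) a b) (chartFrame_mfderiv_chartAt p hx₀ v)
      (chartFrame_mfderiv_chartAt p hx₀ v)).trans_lt hv
  · refine hpos (chartFrame n p (φ p) w) ?_ fun h ↦ hw0 ?_
    · exact (congrArg (fun a ↦ g.metric (φ.symm (φ p)) a (chartFrame n p (φ p) w))
        (chartFrame_mfderiv_chartAt p hx₀ v).symm).trans hw
    · rw [← mfderiv_chartAt_chartFrame p hx₀ w]
      exact (congrArg _ h).trans (map_zero _)

/-- In the preferred chart at `p`, the cones of `g` near `p` form a Lipschitz cone field. -/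
theorem exists_chart_coneField (g : Spacetime n M) (p : M) :
    ∃ r > 0, Metric.closedBall (chartAt (EuclideanSpace ℝ (Fin n)) p p) r ⊆
        (chartAt (EuclideanSpace ℝ (Fin n)) p).target ∧
      ∃ F : LipschitzConeField
          (Metric.closedBall (chartAt (EuclideanSpace ℝ (Fin n)) p p) r),
        ∀ x ∈ Metric.closedBall (chartAt (EuclideanSpace ℝ (Fin n)) p p) r, ∀ v,
          (g.FutureCausal ((chartAt (EuclideanSpace ℝ (Fin n)) p).symm x) (chartFrame n p x v) ↔
            v ∈ F.causal x ∧ v ≠ 0) ∧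
          (g.FutureTimelike ((chartAt (EuclideanSpace ℝ (Fin n)) p).symm x) (chartFrame n p x v) ↔
            v ∈ F.timelike x) := by
  set φ := chartAt (EuclideanSpace ℝ (Fin n)) p with hφ
  have hx₀ : φ p ∈ φ.target := mem_chart_target _ p
  have hneg : ∀ x ∈ φ.target,
      g.coordMetric p x (g.coordTimeField p x) (g.coordTimeField p x) < 0 := fun x hx ↦ by
    rw [coordMetric_apply, chartFrame_coordTimeField g p hx]
    exact g.timeField_timelike _
  have hsig := g.coordMetric_signature p
  obtain ⟨r, hr, hsub, F, hF⟩ := exists_lipschitzConeField (g.coordMetric_symm p)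
    ((g.contDiffAt_coordMetric p).of_le (by norm_cast)) (g.continuousAt_coordTimeField p)
    (hneg _ hx₀) hsig (φ.open_target.mem_nhds hx₀)
  refine ⟨r, hr, hsub, F, fun x hx v ↦ ?_⟩
  have := hF x hx v
  simp only [coordMetric_apply, chartFrame_coordTimeField g p (hsub hx)] at this
  exact ⟨this.1.symm, this.2.symm⟩

end Spacetime

/-! ### Causal curves in a cone field as families of `Prec` relations. -/

/-- A difference quotient of a Lipschitz curve lies in every closed convex set that contains
almost all of its derivatives. -/
lemma smul_sub_mem_of_ae_hasDerivAt {E : Type*} [NormedAddCommGroup E] [NormedSpace ℝ E]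
    {S : Set E} (hconv : Convex ℝ S) (hclosed : IsClosed S) {γ : ℝ → E} {s t : ℝ} (hst : s < t)
    {κ : NNReal} (hlip : LipschitzOnWith κ γ (Icc s t))
    (hder : ∀ᵐ u, u ∈ Icc s t → ∃ v ∈ S, HasDerivAt γ v u) :
    (t - s)⁻¹ • (γ t - γ s) ∈ S := by
  by_contra hnot
  obtain ⟨ψ, a, hS, ha⟩ := geometric_hahn_banach_closed_point hconv hclosed hnot
  have hlip' : LipschitzOnWith (‖ψ‖₊ * κ) (ψ ∘ γ) (uIcc s t) := by
    rw [uIcc_of_le hst.le]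
    exact ψ.lipschitz.comp_lipschitzOnWith hlip
  have hac := hlip'.absolutelyContinuousOnInterval
  have hint := hac.integral_deriv_eq_sub
  have hle : ∫ u in s..t, deriv (ψ ∘ γ) u ≤ ∫ _ in s..t, a := by
    refine intervalIntegral.integral_mono_ae_restrict hst.le hac.intervalIntegrable_deriv
      intervalIntegrable_const ?_
    refine (ae_restrict_iff' measurableSet_Icc).2 ?_
    filter_upwards [hder] with u hu hus
    obtain ⟨v, hv, hd⟩ := hu hus
    rw [(ψ.hasFDerivAt.comp_hasDerivAt u hd).deriv]
    exact (hS v hv).le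
  rw [hint, intervalIntegral.integral_const, smul_eq_mul] at hle
  have h0 : 0 < t - s := sub_pos.2 hst
  rw [map_smul, smul_eq_mul, map_sub, inv_mul_eq_div, lt_div_iff₀ h0] at ha
  simp only [Function.comp_apply] at hle
  linarith

namespace LipschitzConeField

variable {E : Type*} [NormedAddCommGroup E] [NormedSpace ℝ E] {K : Set E}
  (F : LipschitzConeField K)

lemma ℓ_nonneg {x v : E} (hx : x ∈ K) (hv : v ∈ F.causal x) : 0 ≤ F.ℓ v := by
  have h := F.norm_le hx hv
  rcases F.C_nonneg.eq_or_lt with h0 | h0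
  · rw [← h0, zero_mul] at h
    simp [norm_le_zero_iff.1 h]
  · by_contra! h1
    exact absurd ((norm_nonneg v).trans h) (mul_neg_of_pos_of_neg h0 h1).not_ge

lemma smul_T_mem {x : E} {a : ℝ} (hx : x ∈ K) (ha : 0 ≤ a) : a • F.T ∈ F.causal x := by
  rcases ha.eq_or_lt with h | h
  · rw [← h, zero_smul]; exact F.zero_mem hx
  · simpa using F.timelike_subset hx (F.add_smul_T_mem hx (F.zero_mem hx) h)

lemma isClosed_causal_apply {x : E} (hx : x ∈ K) : IsClosed (F.causal x) := by
  have := F.isClosed_causal.preimage (Continuous.prodMk_right x)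
  convert this using 1
  ext v; simp [hx]

lemma convex_causal {x : E} (hx : x ∈ K) : Convex ℝ (F.causal x) := fun _ hv _ hw _ _ ha hb _ ↦
  F.add_mem hx (F.smul_mem hx ha hv) (F.smul_mem hx hb hw)

/-- A closed two-point version of causality: `y - x` is causal at `x` up to a quadratic error. -/
def Prec (x y : E) : Prop :=
  0 ≤ F.ℓ (y - x) ∧ (y - x) + (F.L * F.C * F.ℓ (y - x) ^ 2) • F.T ∈ F.causal x

lemma prec_refl {x : E} (hx : x ∈ K) : F.Prec x x := by
  simpa [Prec] using F.zero_mem hx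

/-- Causal vectors are bounded by `ℓ`, and removing the quadratic correction along `T` adds the
second term. This makes parametrizations by `ℓ` Lipschitz. -/
lemma Prec.norm_sub_le {F : LipschitzConeField K} {x y : E} (h : F.Prec x y) (hx : x ∈ K) :
    ‖y - x‖ ≤ (F.C + (F.C + ‖F.T‖) * (F.L * F.C * F.ℓ (y - x))) * F.ℓ (y - x) := by
  obtain ⟨h0, h1⟩ := h
  set v := y - x
  set a := F.L * F.C * F.ℓ v ^ 2 with ha
  have ha0 : 0 ≤ a := mul_nonneg (mul_nonneg F.L_nonneg F.C_nonneg) (sq_nonneg _)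
  have h2 := F.norm_le hx h1
  rw [map_add, map_smul, F.apply_T, smul_eq_mul, mul_one] at h2
  have h3 : ‖v‖ ≤ ‖v + a • F.T‖ + a * ‖F.T‖ := by
    have := _root_.norm_sub_le (v + a • F.T) (a • F.T)
    rwa [add_sub_cancel_right, norm_smul, Real.norm_of_nonneg ha0] at this
  calc ‖v‖ ≤ F.C * (F.ℓ v + a) + a * ‖F.T‖ := h3.trans (by gcongr)
    _ = _ := by rw [ha]; ring

lemma Prec.eq_of_ℓ_eq {F : LipschitzConeField K} {x y : E} (h : F.Prec x y) (hx : x ∈ K)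
    (h0 : F.ℓ x = F.ℓ y) : x = y := by
  have h1 := h.norm_sub_le hx
  rw [map_sub, h0, sub_self, mul_zero] at h1
  exact (sub_eq_zero.1 (norm_le_zero_iff.1 h1)).symm

lemma prec_of_tendsto {ι : Type*} {𝒰 : Filter ι} [𝒰.NeBot] {a b : ι → E} {x y : E}
    (ha : Tendsto a 𝒰 (𝓝 x)) (hb : Tendsto b 𝒰 (𝓝 y))
    (h : ∀ᶠ i in 𝒰, a i ∈ K ∧ F.Prec (a i) (b i)) : F.Prec x y := by
  have hd : Tendsto (fun i ↦ b i - a i) 𝒰 (𝓝 (y - x)) := hb.sub ha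
  have hl : Tendsto (fun i ↦ F.ℓ (b i - a i)) 𝒰 (𝓝 (F.ℓ (y - x))) :=
    (F.ℓ.continuous.tendsto _).comp hd
  refine ⟨ge_of_tendsto hl (h.mono fun i hi ↦ hi.2.1), ?_⟩
  have hp := ha.prodMk_nhds (hd.add (((hl.pow 2).const_mul (F.L * F.C)).smul_const F.T))
  exact (F.isClosed_causal.mem_of_tendsto hp (h.mono fun i hi ↦ ⟨hi.1, hi.2.2⟩)).2

/-- The increments of a Lipschitz curve with causal derivatives. -/
theorem prec_of_lipschitzOnWith {γ : ℝ → E} {s t : ℝ} (hst : s ≤ t) {κ : NNReal}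
    (hlip : LipschitzOnWith κ γ (Icc s t)) (hK : ∀ u ∈ Icc s t, γ u ∈ K)
    (hder : ∀ᵐ u, u ∈ Icc s t → ∃ v ∈ F.causal (γ u), HasDerivAt γ v u) :
    F.Prec (γ s) (γ t) := by
  have hs : γ s ∈ K := hK s (left_mem_Icc.2 hst)
  rcases hst.eq_or_lt with rfl | hlt
  · exact F.prec_refl hs
  have hcone : Convex ℝ {v : E | ‖v‖ ≤ F.C * F.ℓ v} := by
    intro v hv w hw a b ha hb _
    simp only [mem_ofPred_eq, map_add, map_smul, smul_eq_mul] at hv hw ⊢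
    calc ‖a • v + b • w‖ ≤ a * ‖v‖ + b * ‖w‖ := by
          refine (norm_add_le _ _).trans ?_
          rw [norm_smul, norm_smul, Real.norm_of_nonneg ha, Real.norm_of_nonneg hb]
      _ ≤ a * (F.C * F.ℓ v) + b * (F.C * F.ℓ w) := by gcongr
      _ = _ := by ring
  have hcone' : IsClosed {v : E | ‖v‖ ≤ F.C * F.ℓ v} :=
    isClosed_le continuous_norm (continuous_const.mul F.ℓ.continuous)
  -- A priori bounds from the fixed cone `‖v‖ ≤ C ℓ v`, needed before the variation of the cones
  -- along the curve can be estimated.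
  have hrough : ∀ a b, s ≤ a → a ≤ b → b ≤ t →
      ‖γ b - γ a‖ ≤ F.C * F.ℓ (γ b - γ a) ∧ 0 ≤ F.ℓ (γ b - γ a) := by
    intro a b ha hab hb
    rcases hab.eq_or_lt with rfl | hab'
    · simp
    have hsub : Icc a b ⊆ Icc s t := Icc_subset_Icc ha hb
    have h1 := smul_sub_mem_of_ae_hasDerivAt hcone hcone' hab' (hlip.mono hsub)
      (hder.mono fun u hu hus ↦ by
        obtain ⟨v, hv, hd⟩ := hu (hsub hus)
        exact ⟨v, F.norm_le (hK u (hsub hus)) hv, hd⟩)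
    have h2 := smul_sub_mem_of_ae_hasDerivAt (convex_halfSpace_ge F.ℓ.isLinear 0)
      (isClosed_le continuous_const F.ℓ.continuous) hab' (hlip.mono hsub)
      (hder.mono fun u hu hus ↦ by
        obtain ⟨v, hv, hd⟩ := hu (hsub hus)
        exact ⟨v, F.ℓ_nonneg (hK u (hsub hus)) hv, hd⟩)
    have h3 : 0 < (b - a)⁻¹ := inv_pos.2 (sub_pos.2 hab')
    simp only [mem_ofPred_eq, map_smul, smul_eq_mul, norm_smul, Real.norm_of_nonneg h3.le] at h1 h2
    refine ⟨le_of_mul_le_mul_left ?_ h3, nonneg_of_mul_nonneg_right h2 h3⟩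
    linarith
  refine ⟨(hrough s t le_rfl hst le_rfl).2, ?_⟩
  set d := F.ℓ (γ t - γ s) with hd
  -- `A` makes the correction linear. Since `‖γ s - γ u‖ ≤ C d`, it maps almost every derivative
  -- into the cone at `γ s`; on the whole chord, where `ℓ` equals `d`, it produces exactly the
  -- correction in `Prec`.
  set A : E →L[ℝ] E := ContinuousLinearMap.id ℝ E + (F.L * F.C * d) • F.ℓ.smulRight F.T with hA
  have hAv : ∀ v, A v = v + (F.L * F.C * d * F.ℓ v) • F.T := fun v ↦ by
    simp [hA, mul_smul]
  have h := smul_sub_mem_of_ae_hasDerivAt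
    ((F.convex_causal hs).linear_preimage (A : E →ₗ[ℝ] E))
    ((F.isClosed_causal_apply hs).preimage A.continuous) hlt hlip
    (hder.mono fun u hu hus ↦ by
      obtain ⟨v, hv, hdv⟩ := hu hus
      refine ⟨v, ?_, hdv⟩
      change A v ∈ F.causal (γ s)
      have hl := F.ℓ_nonneg (hK u hus) hv
      have h1 := F.tilt_mem hs (hK u hus) hv
      have h2 : ‖γ s - γ u‖ ≤ F.C * d := by
        rw [norm_sub_rev]
        refine (hrough s u le_rfl hus.1 hus.2).1.trans ?_
        have h3 := (hrough u t hus.1 hus.2 le_rfl).2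
        have h4 : F.ℓ (γ u - γ s) ≤ d := by
          simp only [hd, map_sub] at h3 ⊢; linarith
        exact mul_le_mul_of_nonneg_left h4 F.C_nonneg
      have h5 : 0 ≤ F.L * F.C * d * F.ℓ v - F.L * ‖γ s - γ u‖ * F.ℓ v := by
        have := mul_le_mul_of_nonneg_right (mul_le_mul_of_nonneg_left h2 F.L_nonneg) hl
        linarith
      have h6 := F.add_mem hs h1 (F.smul_T_mem hs h5)
      rw [hAv]
      rwa [add_assoc, ← add_smul, add_sub_cancel] at h6)
  have h0 : 0 < t - s := sub_pos.2 hlt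
  have h7 : A ((t - s)⁻¹ • (γ t - γ s)) ∈ F.causal (γ s) := h
  have h8 := F.smul_mem hs h0.le h7
  rw [← map_smul, smul_smul, mul_inv_cancel₀ h0.ne', one_smul, hAv] at h8
  convert h8 using 3
  ring

/-- `a` and `b` are the endpoints of a curve in `S` with increments in the cones, parametrized
proportionally to the functional `ℓ`. -/
def Link (S : Set E) (a b : E) : Prop :=
  ∃ σ : ℝ → E, σ 0 = a ∧ σ 1 = b ∧
    (∀ s ∈ Icc (0 : ℝ) 1, σ s ∈ S ∧ F.ℓ (σ s) = F.ℓ a + s * F.ℓ (b - a)) ∧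
    ∀ s ∈ Icc (0 : ℝ) 1, ∀ t ∈ Icc (0 : ℝ) 1, s ≤ t → F.Prec (σ s) (σ t)

/-- Along the curve `ℓ` is monotone, and points with equal `ℓ` coincide by `Prec.eq_of_ℓ_eq`. So any
choice of parameters with prescribed values of `ℓ` gives the same reparametrized curve. -/
lemma link_of_curve {S : Set E} (hS : S ⊆ K) {γ : ℝ → E} {α β : ℝ} (hαβ : α ≤ β)
    (hcont : ContinuousOn γ (Icc α β)) (hγ : ∀ u ∈ Icc α β, γ u ∈ S)
    (hprec : ∀ s ∈ Icc α β, ∀ t ∈ Icc α β, s ≤ t → F.Prec (γ s) (γ t)) :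
    F.Link S (γ α) (γ β) := by
  have hinj : ∀ u ∈ Icc α β, ∀ w ∈ Icc α β, F.ℓ (γ u) = F.ℓ (γ w) → γ u = γ w := by
    intro u hu w hw h
    rcases le_total u w with huw | huw
    · exact (hprec u hu w hw huw).eq_of_ℓ_eq (hS (hγ u hu)) h
    · exact ((hprec w hw u hu huw).eq_of_ℓ_eq (hS (hγ w hw)) h.symm).symm
  have hmono : ∀ u ∈ Icc α β, ∀ w ∈ Icc α β, u ≤ w → F.ℓ (γ u) ≤ F.ℓ (γ w) := by
    intro u hu w hw h
    have := (hprec u hu w hw h).1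
    rwa [map_sub, sub_nonneg] at this
  have hα := left_mem_Icc.2 hαβ
  have hβ := right_mem_Icc.2 hαβ
  have hd := hmono α hα β hβ hαβ
  have hex : ∀ s ∈ Icc (0 : ℝ) 1, ∃ u ∈ Icc α β,
      F.ℓ (γ u) = F.ℓ (γ α) + s * F.ℓ (γ β - γ α) := by
    intro s hs
    have hc : ContinuousOn (fun u ↦ F.ℓ (γ u)) (Icc α β) := F.ℓ.continuous.comp_continuousOn hcont
    refine intermediate_value_Icc hαβ hc ⟨?_, ?_⟩
    · simp only [map_sub]
      nlinarith [hs.1]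
    · simp only [map_sub]
      nlinarith [hs.2]
  choose! u hu hℓu using hex
  have h0 : (0 : ℝ) ∈ Icc (0 : ℝ) 1 := by simp
  have h1 : (1 : ℝ) ∈ Icc (0 : ℝ) 1 := by simp
  refine ⟨fun s ↦ γ (u s), ?_, ?_, fun s hs ↦ ⟨hγ _ (hu s hs), hℓu s hs⟩, ?_⟩
  · exact hinj _ (hu 0 h0) _ hα (by rw [hℓu 0 h0]; simp)
  · exact hinj _ (hu 1 h1) _ hβ (by rw [hℓu 1 h1]; simp)
  · intro s hs t ht hst
    rcases le_total (u s) (u t) with h | h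
    · exact hprec _ (hu s hs) _ (hu t ht) h
    -- The chosen parameters may come in the wrong order, but then the two points coincide.
    · have h2 := hmono _ (hu t ht) _ (hu s hs) h
      have h3 : F.ℓ (γ (u s)) ≤ F.ℓ (γ (u t)) := by
        rw [hℓu s hs, hℓu t ht, map_sub]
        nlinarith
      have h4 := hinj _ (hu s hs) _ (hu t ht) (le_antisymm h3 h2)
      simp only [h4]
      exact F.prec_refl (hS (hγ _ (hu t ht)))

/-- Parametrization by `ℓ` removes the freedom of reparametrization, and the remaining conditions on
the values of `σ` are closed. Pointwise ultrafilter limits in the compact set therefore suffice: the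
limiting `Prec` relations carry both the Lipschitz bound and causality. -/
lemma link_of_tendsto {S : Set E} (hSc : IsCompact S) (hS : S ⊆ K) {ι : Type*} {𝒰 : Ultrafilter ι}
    {a b : ι → E} {x y : E} (ha : Tendsto a 𝒰 (𝓝 x)) (hb : Tendsto b 𝒰 (𝓝 y))
    (h : ∀ᶠ i in (𝒰 : Filter ι), F.Link S (a i) (b i)) : F.Link S x y := by
  have hex : ∀ i, ∃ σ : ℝ → E, F.Link S (a i) (b i) → σ 0 = a i ∧ σ 1 = b i ∧
      (∀ s ∈ Icc (0 : ℝ) 1, σ s ∈ S ∧ F.ℓ (σ s) = F.ℓ (a i) + s * F.ℓ (b i - a i)) ∧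
      ∀ s ∈ Icc (0 : ℝ) 1, ∀ t ∈ Icc (0 : ℝ) 1, s ≤ t → F.Prec (σ s) (σ t) := by
    intro i
    by_cases hi : F.Link S (a i) (b i)
    · obtain ⟨σ, hσ⟩ := hi
      exact ⟨σ, fun _ ↦ hσ⟩
    · exact ⟨fun _ ↦ 0, fun h ↦ absurd h hi⟩
  choose σ hσ using hex
  have hlim : ∀ s, ∃ z, s ∈ Icc (0 : ℝ) 1 → z ∈ S ∧ Tendsto (fun i ↦ σ i s) 𝒰 (𝓝 z) := by
    intro s
    by_cases hs : s ∈ Icc (0 : ℝ) 1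
    · obtain ⟨z, hz, hzt⟩ := hSc.ultrafilter_le_nhds' (𝒰.map fun i ↦ σ i s)
        (h.mono fun i hi ↦ ((hσ i hi).2.2.1 s hs).1)
      exact ⟨z, fun _ ↦ ⟨hz, hzt⟩⟩
    · exact ⟨0, fun h ↦ absurd h hs⟩
  choose τ hτ using hlim
  have h0 : (0 : ℝ) ∈ Icc (0 : ℝ) 1 := by simp
  have h1 : (1 : ℝ) ∈ Icc (0 : ℝ) 1 := by simp
  refine ⟨τ, ?_, ?_, fun s hs ↦ ⟨(hτ s hs).1, ?_⟩, fun s hs t ht hst ↦ ?_⟩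
  · exact tendsto_nhds_unique ((hτ 0 h0).2.congr' (h.mono fun i hi ↦ (hσ i hi).1)) ha
  · exact tendsto_nhds_unique ((hτ 1 h1).2.congr' (h.mono fun i hi ↦ (hσ i hi).2.1)) hb
  · refine tendsto_nhds_unique ((F.ℓ.continuous.tendsto _).comp (hτ s hs).2) ?_
    have h2 : Tendsto (fun i ↦ F.ℓ (a i) + s * F.ℓ (b i - a i)) 𝒰
        (𝓝 (F.ℓ x + s * F.ℓ (y - x))) :=
      ((F.ℓ.continuous.tendsto _).comp ha).add
        (((F.ℓ.continuous.tendsto _).comp (hb.sub ha)).const_mul s)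
    exact h2.congr' (h.mono fun i hi ↦ (((hσ i hi).2.2.1 s hs).2).symm)
  · exact F.prec_of_tendsto (hτ s hs).2 (hτ t ht).2
      (h.mono fun i hi ↦ ⟨hS ((hσ i hi).2.2.1 s hs).1, (hσ i hi).2.2.2 s hs t ht hst⟩)

/-- The straight segment from `x` to `y` lies in `K` and is timelike. -/
def TimelikeChord (x y : E) : Prop :=
  ∀ θ ∈ Icc (0 : ℝ) 1, x + θ • (y - x) ∈ K ∧ y - x ∈ F.timelike (x + θ • (y - x))

section Curve

variable {S : Set E} {a b : E} {σ : ℝ → E}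

lemma norm_sub_le_of_link (hS : S ⊆ K)
    (hℓ : ∀ s ∈ Icc (0 : ℝ) 1, σ s ∈ S ∧ F.ℓ (σ s) = F.ℓ a + s * F.ℓ (b - a))
    (hprec : ∀ s ∈ Icc (0 : ℝ) 1, ∀ t ∈ Icc (0 : ℝ) 1, s ≤ t → F.Prec (σ s) (σ t))
    (hab : 0 ≤ F.ℓ (b - a)) :
    ∀ s ∈ Icc (0 : ℝ) 1, ∀ t ∈ Icc (0 : ℝ) 1, s ≤ t → ‖σ t - σ s‖ ≤
      (F.C + (F.C + ‖F.T‖) * (F.L * F.C * F.ℓ (b - a))) * F.ℓ (b - a) * (t - s) := by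
  intro s hs t ht hst
  have h1 := (hprec s hs t ht hst).norm_sub_le (hS (hℓ s hs).1)
  have h2 : F.ℓ (σ t - σ s) = F.ℓ (b - a) * (t - s) := by
    rw [map_sub, (hℓ s hs).2, (hℓ t ht).2]; ring
  have h3 : F.ℓ (b - a) * (t - s) ≤ F.ℓ (b - a) :=
    mul_le_of_le_one_right hab (by linarith [hs.1, ht.2])
  have hC := F.C_nonneg
  have hL := F.L_nonneg
  have h4 : 0 ≤ t - s := sub_nonneg.2 hst
  rw [h2] at h1
  refine h1.trans ?_
  rw [mul_assoc _ (F.ℓ (b - a)) (t - s)]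
  gcongr

lemma lipschitzOnWith_of_link (hS : S ⊆ K)
    (hℓ : ∀ s ∈ Icc (0 : ℝ) 1, σ s ∈ S ∧ F.ℓ (σ s) = F.ℓ a + s * F.ℓ (b - a))
    (hprec : ∀ s ∈ Icc (0 : ℝ) 1, ∀ t ∈ Icc (0 : ℝ) 1, s ≤ t → F.Prec (σ s) (σ t))
    (hab : 0 ≤ F.ℓ (b - a)) : ∃ κ, LipschitzOnWith κ σ (Icc (0 : ℝ) 1) := by
  have h := F.norm_sub_le_of_link hS hℓ hprec hab
  refine ⟨Real.toNNReal ((F.C + (F.C + ‖F.T‖) * (F.L * F.C * F.ℓ (b - a))) * F.ℓ (b - a)),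
    LipschitzOnWith.of_dist_le_mul fun s hs t ht ↦ ?_⟩
  have hC := F.C_nonneg
  have hL := F.L_nonneg
  rw [Real.coe_toNNReal _ (by positivity), dist_eq_norm, Real.dist_eq]
  rcases le_total s t with hst | hst
  · rw [norm_sub_rev, abs_sub_comm, abs_of_nonneg (sub_nonneg.2 hst)]
    exact h s hs t ht hst
  · rw [abs_of_nonneg (sub_nonneg.2 hst)]
    exact h t ht s hs hst

/-- The quadratic error in `Prec` vanishes in the limit of difference quotients, and the cones are
closed. -/
lemma mem_causal_of_hasDerivAt (hS : S ⊆ K)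
    (hℓ : ∀ s ∈ Icc (0 : ℝ) 1, σ s ∈ S ∧ F.ℓ (σ s) = F.ℓ a + s * F.ℓ (b - a))
    (hprec : ∀ s ∈ Icc (0 : ℝ) 1, ∀ t ∈ Icc (0 : ℝ) 1, s ≤ t → F.Prec (σ s) (σ t))
    {t : ℝ} (ht : t ∈ Ioo (0 : ℝ) 1) {v : E} (hv : HasDerivAt σ v t) :
    v ∈ F.causal (σ t) ∧ F.ℓ v = F.ℓ (b - a) := by
  have htI : t ∈ Icc (0 : ℝ) 1 := Ioo_subset_Icc_self ht
  have hslope : Tendsto (fun u ↦ (u - t)⁻¹ • (σ u - σ t)) (𝓝[>] t) (𝓝 v) := by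
    have := hasDerivAt_iff_tendsto_slope.1 hv
    exact this.mono_left (nhdsWithin_mono _ fun u hu ↦ (mem_Ioi.1 hu).ne')
  have hev : ∀ᶠ u in 𝓝[>] t, u ∈ Ioo t 1 := Ioo_mem_nhdsGT ht.2
  have hdiff : ∀ u ∈ Ioo t 1, F.ℓ (σ u - σ t) = (u - t) * F.ℓ (b - a) := fun u hu ↦ by
    rw [map_sub, (hℓ t htI).2, (hℓ u ⟨ht.1.le.trans hu.1.le, hu.2.le⟩).2]; ring
  constructor
  · have h1 : Tendsto (fun u ↦ (u - t)⁻¹ • (σ u - σ t) +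
        (F.L * F.C * (F.ℓ (b - a)) ^ 2 * (u - t)) • F.T) (𝓝[>] t)
        (𝓝 (v + (F.L * F.C * (F.ℓ (b - a)) ^ 2 * (t - t)) • F.T)) := by
      refine hslope.add ?_
      exact Tendsto.mono_left (Continuous.tendsto (by fun_prop) t) nhdsWithin_le_nhds
    rw [sub_self, mul_zero, zero_smul, add_zero] at h1
    refine (F.isClosed_causal_apply (hS (hℓ t htI).1)).mem_of_tendsto h1 (hev.mono fun u hu ↦ ?_)
    have h0 : 0 < u - t := sub_pos.2 hu.1
    have h2 := (hprec t htI u ⟨ht.1.le.trans hu.1.le, hu.2.le⟩ hu.1.le).2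
    have h3 := F.smul_mem (hS (hℓ t htI).1) (inv_nonneg.2 h0.le) h2
    rw [smul_add, smul_smul, hdiff u hu] at h3
    convert h3 using 3
    field_simp
  · have h1 := (F.ℓ.continuous.tendsto v).comp hslope
    refine tendsto_nhds_unique h1 (tendsto_const_nhds.congr' (hev.mono fun u hu ↦ ?_))
    have h0 : 0 < u - t := sub_pos.2 hu.1
    simp only [Function.comp_apply, map_smul, hdiff u hu, smul_eq_mul]
    field_simp

end Curve

lemma Link.ℓ_nonneg {F : LipschitzConeField K} {S : Set E} {a b : E} (h : F.Link S a b) :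
    0 ≤ F.ℓ (b - a) := by
  obtain ⟨σ, rfl, rfl, -, hprec⟩ := h
  exact (hprec 0 (by simp) 1 (by simp) zero_le_one).1

end LipschitzConeField

/-! ### Push-up in a cone field. -/

namespace LipschitzConeField

variable {E : Type*} [NormedAddCommGroup E] [NormedSpace ℝ E] {K : Set E}
  (F : LipschitzConeField K)

/-- Tilting a causal curve into the future makes its short chords timelike. -/
theorem exists_timelikeChord_of_link (hconv : Convex ℝ K) {S : Set E} (hS : S ⊆ K) {a b : E}
    {σ : ℝ → E} (haK : a ∈ K) (hbK : b ∈ K)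
    (hℓ : ∀ s ∈ Icc (0 : ℝ) 1, σ s ∈ S ∧ F.ℓ (σ s) = F.ℓ a + s * F.ℓ (b - a))
    (hprec : ∀ s ∈ Icc (0 : ℝ) 1, ∀ t ∈ Icc (0 : ℝ) 1, s ≤ t → F.Prec (σ s) (σ t))
    (hab : 0 ≤ F.ℓ (b - a)) {δ c : ℝ} (hδ : 0 < δ) (hc : c ∈ Icc (-1 : ℝ) 0)
    (hK : ∀ x ∈ S, ∀ r ∈ Icc (-δ) δ, x + r • F.T ∈ K) :
    ∃ h₀ > 0, ∀ s ∈ Icc (0 : ℝ) 1, ∀ t ∈ Icc (0 : ℝ) 1, s < t → t - s < h₀ →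
      F.TimelikeChord (σ s + (δ * (s + c)) • F.T) (σ t + (δ * (t + c)) • F.T) := by
  set κ := F.ℓ (b - a) with hκ
  set B := (F.C + (F.C + ‖F.T‖) * (F.L * F.C * κ)) * κ with hB
  have hC := F.C_nonneg
  have hL := F.L_nonneg
  have hB0 : 0 ≤ B := by positivity
  have hbound := F.norm_sub_le_of_link hS hℓ hprec hab
  rw [← hκ, ← hB] at hbound
  have hsmall := F.small haK hbK
  rw [← hκ] at hsmall
  -- At `h = 0` the left side is `L δ‖T‖κ`, which is below `δ` by `small`. Multiplied by `h`, the
  -- inequality bounds the errors `e₁ + e₂` below by the tilt `δ h`.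
  obtain ⟨h₀, hh₀, hlt⟩ : ∃ h₀ > 0, ∀ h ∈ Ioo (0 : ℝ) h₀, F.L * F.C * κ ^ 2 * h +
      F.L * (δ * ‖F.T‖ + (B + δ * ‖F.T‖) * h) * (κ + F.L * F.C * κ ^ 2 * h) < δ := by
    have hcont : Continuous fun h : ℝ ↦ F.L * F.C * κ ^ 2 * h +
      F.L * (δ * ‖F.T‖ + (B + δ * ‖F.T‖) * h) * (κ + F.L * F.C * κ ^ 2 * h) := by fun_prop
    have h0 := (hcont.tendsto 0).eventually_lt_const (u := δ) (by
      simp only [mul_zero, zero_add, add_zero]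
      nlinarith)
    obtain ⟨ε, hε, hball⟩ := Metric.eventually_nhds_iff.1 h0
    refine ⟨ε, hε, fun h hh ↦ hball ?_⟩
    rw [Real.dist_eq, sub_zero, abs_of_pos hh.1]
    exact hh.2
  refine ⟨h₀, hh₀, fun s hs t ht hst hth ↦ ?_⟩
  set h := t - s with hh
  have hpos : 0 < h := sub_pos.2 hst
  have hkey := hlt h ⟨hpos, hth⟩
  have hpK : ∀ u ∈ Icc (0 : ℝ) 1, σ u + (δ * (u + c)) • F.T ∈ K := fun u hu ↦
    hK _ (hℓ u hu).1 _ ⟨by nlinarith [hu.1, hc.1], by nlinarith [hu.2, hc.2]⟩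
  set v := σ t - σ s with hv
  set w := (σ t + (δ * (t + c)) • F.T) - (σ s + (δ * (s + c)) • F.T) with hw
  have hwv : w = v + (δ * h) • F.T := by
    rw [hw, hv, hh]; module
  have hvn : ‖v‖ ≤ B * h := hbound s hs t ht hst.le
  have hwn : ‖w‖ ≤ (B + δ * ‖F.T‖) * h := by
    rw [hwv]
    refine (norm_add_le _ _).trans ?_
    rw [norm_smul, Real.norm_of_nonneg (by positivity)]
    linarith
  intro θ hθ
  have hyK : σ s + (δ * (s + c)) • F.T + θ • w ∈ K :=
    hconv.add_smul_sub_mem (hpK s hs) (hpK t ht) hθ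
  refine ⟨hyK, ?_⟩
  set y := σ s + (δ * (s + c)) • F.T + θ • w with hy
  have hyn : ‖y - σ s‖ ≤ δ * ‖F.T‖ + (B + δ * ‖F.T‖) * h := by
    have h1 : y - σ s = (δ * (s + c)) • F.T + θ • w := by rw [hy]; abel
    rw [h1]
    refine (norm_add_le _ _).trans (add_le_add ?_ ?_)
    · rw [norm_smul, Real.norm_eq_abs, abs_mul, abs_of_pos hδ]
      have h2 : |s + c| ≤ 1 := abs_le.2 ⟨by linarith [hs.1, hc.1], by linarith [hs.2, hc.2]⟩
      have : δ * |s + c| ≤ δ := mul_le_of_le_one_right hδ.le h2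
      gcongr
    · rw [norm_smul, Real.norm_of_nonneg hθ.1]
      exact (mul_le_of_le_one_left (norm_nonneg _) hθ.2).trans hwn
  have hℓv : F.ℓ v = κ * h := by
    rw [hv, map_sub, (hℓ s hs).2, (hℓ t ht).2]; ring
  have h1 := (hprec s hs t ht hst.le).2
  rw [← hv, hℓv] at h1
  have h2 := F.tilt_mem hyK (hS (hℓ s hs).1) h1
  rw [map_add, map_smul, F.apply_T, smul_eq_mul, mul_one, hℓv] at h2
  -- `e₁` is the correction in `Prec`, and `e₂` is the cost of moving the base point from `σ s` to
  -- the point `y` of the chord.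
  set e₁ := F.L * F.C * (κ * h) ^ 2 with he₁
  set e₂ := F.L * ‖y - σ s‖ * (κ * h + e₁) with he₂
  have hρ : 0 < δ * h - e₁ - e₂ := by
    have h3 : e₂ ≤ F.L * (δ * ‖F.T‖ + (B + δ * ‖F.T‖) * h) * (κ * h + e₁) := by
      rw [he₂]; gcongr
    have h4 := mul_lt_mul_of_pos_right hkey hpos
    rw [he₁] at h3 ⊢
    linarith
  have h5 := F.add_smul_T_mem hyK h2 hρ
  convert h5 using 1
  rw [← hw, hwv]; module

/-- Push-up along a causal curve in a chart. -/
theorem transGen_timelikeChord_of_link (hconv : Convex ℝ K) {S : Set E} (hS : S ⊆ K) {a b : E}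
    (hlink : F.Link S a b) {δ c : ℝ} (hδ : 0 < δ) (hc : c ∈ Icc (-1 : ℝ) 0)
    (hK : ∀ x ∈ S, ∀ r ∈ Icc (-δ) δ, x + r • F.T ∈ K) :
    Relation.TransGen F.TimelikeChord (a + (δ * c) • F.T) (b + (δ * (1 + c)) • F.T) := by
  have hab := hlink.ℓ_nonneg
  obtain ⟨σ, hσ0, hσ1, hℓ, hprec⟩ := hlink
  have haK : a ∈ K := hσ0 ▸ hS (hℓ 0 (by simp)).1
  have hbK : b ∈ K := hσ1 ▸ hS (hℓ 1 (by simp)).1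
  obtain ⟨h₀, hh₀, hchord⟩ :=
    F.exists_timelikeChord_of_link hconv hS haK hbK hℓ hprec hab hδ hc hK
  obtain ⟨N, hN⟩ := exists_nat_one_div_lt hh₀
  have hN0 : (0 : ℝ) < N + 1 := by positivity
  set p : ℕ → E := fun k ↦ σ (k / (N + 1)) + (δ * (k / (N + 1) + c)) • F.T with hp
  have hmem : ∀ k : ℕ, k ≤ N + 1 → (k : ℝ) / (N + 1) ∈ Icc (0 : ℝ) 1 := fun k hk ↦
    ⟨by positivity, (div_le_one hN0).2 (by exact_mod_cast hk)⟩
  have hstep : ∀ k : ℕ, k + 1 ≤ N + 1 → F.TimelikeChord (p k) (p (k + 1)) := fun k hk ↦ by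
    have hd : ((k + 1 : ℕ) : ℝ) / (N + 1) - (k : ℝ) / (N + 1) = 1 / (N + 1) := by
      push_cast; field_simp; ring
    have hd' : (0 : ℝ) < 1 / (N + 1) := by positivity
    exact hchord _ (hmem k (by omega)) _ (hmem (k + 1) hk) (by linarith) (by rw [hd]; exact hN)
  have hall : ∀ k : ℕ, k + 1 ≤ N + 1 → Relation.TransGen F.TimelikeChord (p 0) (p (k + 1)) := by
    intro k
    induction k with
    | zero => exact fun h ↦ .single (hstep 0 h)
    | succ k ih => exact fun h ↦ (ih (by omega)).tail (hstep _ h)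
  have h := hall N le_rfl
  have e0 : p 0 = a + (δ * c) • F.T := by simp [hp, hσ0]
  have e1 : p (N + 1) = b + (δ * (1 + c)) • F.T := by
    simp only [hp]
    push_cast
    rw [div_self hN0.ne', hσ1]
  rwa [e0, e1] at h

end LipschitzConeField

/-! ### Restriction, reparametrization and concatenation of causal curves. -/

lemma lipschitzOnWith_union_of_le {X : Type*} [PseudoMetricSpace X] {f : ℝ → X} {b : ℝ}
    {u v : Set ℝ} {K L : NNReal} (hu : ∀ t ∈ u, t ≤ b) (hv : ∀ t ∈ v, b ≤ t) (hbu : b ∈ u)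
    (hbv : b ∈ v) (hf : LipschitzOnWith K f u) (hg : LipschitzOnWith L f v) :
    LipschitzOnWith (K + L) f (u ∪ v) := by
  have key : ∀ s ∈ u, ∀ t ∈ v, dist (f s) (f t) ≤ (K + L) * dist s t := by
    intro s hs t ht
    have h1 := hf.dist_le_mul s hs b hbu
    have h2 := hg.dist_le_mul b hbv t ht
    rw [Real.dist_eq, abs_sub_comm, abs_of_nonneg (sub_nonneg.2 (hu s hs))] at h1
    rw [Real.dist_eq, abs_sub_comm, abs_of_nonneg (sub_nonneg.2 (hv t ht))] at h2
    rw [Real.dist_eq, abs_sub_comm,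
      abs_of_nonneg (sub_nonneg.2 ((hu s hs).trans (hv t ht)))]
    have h3 := dist_triangle (f s) (f b) (f t)
    have h4 : 0 ≤ (K : ℝ) * (t - b) := mul_nonneg K.2 (sub_nonneg.2 (hv t ht))
    have h5 : 0 ≤ (L : ℝ) * (b - s) := mul_nonneg L.2 (sub_nonneg.2 (hu s hs))
    linarith
  refine LipschitzOnWith.of_dist_le_mul fun s hs t ht ↦ ?_
  rw [NNReal.coe_add]
  rcases hs with hs | hs <;> rcases ht with ht | ht
  · exact (hf.dist_le_mul s hs t ht).trans (by gcongr; simp)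
  · exact key s hs t ht
  · rw [dist_comm, dist_comm s t]; exact key t ht s hs
  · exact (hg.dist_le_mul s hs t ht).trans (by gcongr; simp)

namespace Spacetime

variable {n : ℕ} {M : Type*} [TopologicalSpace M]
  [ChartedSpace (EuclideanSpace ℝ (Fin n)) M] [IsManifold (𝓡 n) ∞ M] {g : Spacetime n M}

lemma FutureCausal.smul {x : M} {v : TangentSpace (𝓡 n) x} (h : g.FutureCausal x v) {a : ℝ}
    (ha : 0 < a) : g.FutureCausal x (a • v) := by
  obtain ⟨h1, h2⟩ := h
  constructor
  · simp only [map_smul, smul_apply, smul_eq_mul]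
    exact mul_nonpos_of_nonneg_of_nonpos ha.le (mul_nonpos_of_nonneg_of_nonpos ha.le h1)
  · simp only [map_smul, smul_eq_mul]
    exact mul_neg_of_pos_of_neg ha h2

lemma FutureTimelike.smul {x : M} {v : TangentSpace (𝓡 n) x} (h : g.FutureTimelike x v) {a : ℝ}
    (ha : 0 < a) : g.FutureTimelike x (a • v) := by
  obtain ⟨h1, h2⟩ := h
  constructor
  · simp only [map_smul, smul_apply, smul_eq_mul]
    exact mul_neg_of_pos_of_neg ha (mul_neg_of_pos_of_neg ha h1)
  · simp only [map_smul, smul_eq_mul]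
    exact mul_neg_of_pos_of_neg ha h2

lemma FutureTimelike.futureCausal {x : M} {v : TangentSpace (𝓡 n) x} (h : g.FutureTimelike x v) :
    g.FutureCausal x v := ⟨h.1.le, h.2⟩

lemma FutureCausal.congr_point {x y : M} {v w : EuclideanSpace ℝ (Fin n)}
    (h : g.FutureCausal x v) (hxy : x = y) (hvw : v = w) : g.FutureCausal y w := by
  subst hxy hvw; exact h

lemma FutureTimelike.congr_point {x y : M} {v w : EuclideanSpace ℝ (Fin n)}
    (h : g.FutureTimelike x v) (hxy : x = y) (hvw : v = w) : g.FutureTimelike y w := by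
  subst hxy hvw; exact h

lemma FutureCausal.congr_of_eventuallyEq {γ γ' : ℝ → M} {t : ℝ}
    (h : g.FutureCausal (γ t) (mfderiv 𝓘(ℝ) (𝓡 n) γ t (1 : ℝ))) (hγ : γ =ᶠ[𝓝 t] γ') :
    g.FutureCausal (γ' t) (mfderiv 𝓘(ℝ) (𝓡 n) γ' t (1 : ℝ)) := by
  refine h.congr_point hγ.self_of_nhds ?_
  have := hγ.mfderiv_eq (I := 𝓘(ℝ)) (I' := 𝓡 n)
  exact DFunLike.congr_fun this (1 : ℝ)

lemma FutureCausal.mdifferentiableAt {γ : ℝ → M} {t : ℝ}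
    (h : g.FutureCausal (γ t) (mfderiv 𝓘(ℝ) (𝓡 n) γ t (1 : ℝ))) :
    MDifferentiableAt 𝓘(ℝ) (𝓡 n) γ t := by
  by_contra hd
  have h2 := h.2
  rw [mfderiv_zero_of_not_mdifferentiableAt hd] at h2
  have : g.metric (γ t) (g.timeField (γ t)) 0 < 0 := h2
  simp at this

namespace IsCausalCurveOn

lemma mono {γ : ℝ → M} {s s' : Set ℝ} (h : g.IsCausalCurveOn γ s) (hs : s' ⊆ s) :
    g.IsCausalCurveOn γ s' := by
  refine ⟨h.1.mono hs, fun t ht ↦ ?_, h.2.2.mono fun t ht hts ↦ ht (hs hts)⟩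
  obtain ⟨K, u, hu, hK⟩ := h.2.1 t (hs ht)
  exact ⟨K, u, nhdsWithin_mono t hs hu, hK⟩

/-- Outside the interval the curves may differ, which can alter the two-sided derivative only at the
two endpoints, a null set. -/
lemma congr {γ γ' : ℝ → M} {a b : ℝ} (h : g.IsCausalCurveOn γ (Icc a b))
    (hγ : EqOn γ γ' (Icc a b)) : g.IsCausalCurveOn γ' (Icc a b) := by
  refine ⟨h.1.congr hγ.symm, fun t ht ↦ ?_, ?_⟩
  · obtain ⟨K, u, hu, hK⟩ := h.2.1 t ht
    refine ⟨K, u ∩ Icc a b, inter_mem hu self_mem_nhdsWithin, ?_⟩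
    rw [← hγ ht]
    intro x hx y hy
    simp only [Function.comp_apply, ← hγ hx.2, ← hγ hy.2]
    exact hK hx.1 hy.1
  · filter_upwards [h.2.2, volume.ae_ne a, volume.ae_ne b] with t ht hta htb hts
    refine (ht hts).congr_of_eventuallyEq (hγ.eventuallyEq_of_mem ?_)
    exact Icc_mem_nhds (hts.1.lt_of_ne hta.symm) (hts.2.lt_of_ne htb)

/-- The almost-everywhere condition survives because nonconstant affine maps pull null sets back to
null sets. -/
lemma comp_affine {γ : ℝ → M} {s : Set ℝ} (h : g.IsCausalCurveOn γ s) {a : ℝ} (ha : 0 < a)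
    (b : ℝ) : g.IsCausalCurveOn (fun t ↦ γ (a * t + b)) ((fun t ↦ a * t + b) ⁻¹' s) := by
  have hc : Continuous fun t : ℝ ↦ a * t + b := by fun_prop
  refine ⟨h.1.comp hc.continuousOn fun t ht ↦ ht, fun t ht ↦ ?_, ?_⟩
  · obtain ⟨K, u, hu, hK⟩ := h.2.1 _ ht
    refine ⟨K * a.toNNReal, (fun t ↦ a * t + b) ⁻¹' u,
      hc.continuousWithinAt.tendsto_nhdsWithin (fun t ht ↦ ht) hu, ?_⟩
    refine hK.comp (LipschitzOnWith.of_dist_le_mul fun x _ y _ ↦ ?_) fun t ht ↦ ht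
    rw [Real.coe_toNNReal _ ha.le, Real.dist_eq, Real.dist_eq, ← abs_of_pos ha, ← abs_mul,
      abs_of_pos ha]
    exact le_of_eq (by congr 1; ring)
  · have hq : Tendsto (fun t : ℝ ↦ a * t + b) (ae volume) (ae volume) := by
      have h1 : Measure.QuasiMeasurePreserving (fun t : ℝ ↦ a * t) volume volume := by
        refine ⟨by fun_prop, ?_⟩
        rw [Real.map_volume_mul_left ha.ne']
        exact Measure.smul_absolutelyContinuous
      exact ((measurePreserving_add_right volume b).quasiMeasurePreserving.comp h1).tendsto_ae
    filter_upwards [hq.eventually h.2.2] with t ht hts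
    have h1 := ht hts
    have hd : HasDerivAt (fun t : ℝ ↦ a * t + b) a t := by
      simpa using ((hasDerivAt_id t).const_mul a).add_const b
    have h2 : mfderiv 𝓘(ℝ) (𝓡 n) (γ ∘ fun t ↦ a * t + b) t (1 : ℝ) =
        mfderiv 𝓘(ℝ) (𝓡 n) γ (a * t + b) a := by
      rw [mfderiv_comp t (I' := 𝓘(ℝ)) h1.mdifferentiableAt hd.differentiableAt.mdifferentiableAt]
      change mfderiv 𝓘(ℝ) (𝓡 n) γ (a * t + b) (mfderiv 𝓘(ℝ) 𝓘(ℝ) (fun t ↦ a * t + b) t (1 : ℝ)) = _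
      congr 1
      rw [mfderiv_eq_fderiv]
      exact hd.deriv
    have h3 : mfderiv 𝓘(ℝ) (𝓡 n) γ (a * t + b) a =
        a • mfderiv 𝓘(ℝ) (𝓡 n) γ (a * t + b) (1 : ℝ) := by
      have h4 := (mfderiv 𝓘(ℝ) (𝓡 n) γ (a * t + b)).map_smul a (1 : ℝ)
      rw [← h4]
      congr 1
      exact (mul_one a).symm
    exact (h1.smul ha).congr_point rfl (h3.symm.trans h2.symm)

lemma union {γ : ℝ → M} {a b c : ℝ} (hab : a ≤ b) (hbc : b ≤ c)
    (h₁ : g.IsCausalCurveOn γ (Icc a b)) (h₂ : g.IsCausalCurveOn γ (Icc b c)) :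
    g.IsCausalCurveOn γ (Icc a c) := by
  have hU : Icc a b ∪ Icc b c = Icc a c := Icc_union_Icc_eq_Icc hab hbc
  refine ⟨?_, fun t ht ↦ ?_, ?_⟩
  · rw [← hU]
    exact h₁.1.union_of_isClosed h₂.1 isClosed_Icc isClosed_Icc
  · rcases lt_trichotomy t b with htb | rfl | htb
    · obtain ⟨K, u, hu, hK⟩ := h₁.2.1 t ⟨ht.1, htb.le⟩
      refine ⟨K, u, ?_, hK⟩
      have : Icc a b ∈ 𝓝[Icc a c] t := by
        filter_upwards [self_mem_nhdsWithin, mem_nhdsWithin_of_mem_nhds (Iio_mem_nhds htb)]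
          with s hs hsb using ⟨hs.1, hsb.le⟩
      exact nhdsWithin_le_of_mem this hu
    · obtain ⟨K, u, hu, hK⟩ := h₁.2.1 t (right_mem_Icc.2 hab)
      obtain ⟨L, v, hv, hL⟩ := h₂.2.1 t (left_mem_Icc.2 hbc)
      refine ⟨K + L, (u ∩ Icc a t) ∪ (v ∩ Icc t c), ?_, ?_⟩
      · rw [← hU, nhdsWithin_union]
        exact union_mem_sup (inter_mem hu self_mem_nhdsWithin)
          (inter_mem hv self_mem_nhdsWithin)
      · exact lipschitzOnWith_union_of_le (fun s hs ↦ hs.2.2) (fun s hs ↦ hs.2.1)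
          ⟨mem_of_mem_nhdsWithin (right_mem_Icc.2 hab) hu, right_mem_Icc.2 hab⟩
          ⟨mem_of_mem_nhdsWithin (left_mem_Icc.2 hbc) hv, left_mem_Icc.2 hbc⟩
          (hK.mono inter_subset_left) (hL.mono inter_subset_left)
    · obtain ⟨K, u, hu, hK⟩ := h₂.2.1 t ⟨htb.le, ht.2⟩
      refine ⟨K, u, ?_, hK⟩
      have : Icc b c ∈ 𝓝[Icc a c] t := by
        filter_upwards [self_mem_nhdsWithin, mem_nhdsWithin_of_mem_nhds (Ioi_mem_nhds htb)]
          with s hs hsb using ⟨hsb.le, hs.2⟩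
      exact nhdsWithin_le_of_mem this hu
  · filter_upwards [h₁.2.2, h₂.2.2] with t h1 h2 ht
    rw [← hU] at ht
    exact ht.elim h1 h2

end IsCausalCurveOn

/-- `x` and `y` are the endpoints of a nondegenerate causal curve. -/
def CausalArc (g : Spacetime n M) (x y : M) : Prop :=
  ∃ γ : ℝ → M, g.IsCausalCurveOn γ (Icc 0 1) ∧ γ 0 = x ∧ γ 1 = y

lemma IsCausalCurveOn.causalArc {γ : ℝ → M} {a b : ℝ} (hab : a < b)
    (h : g.IsCausalCurveOn γ (Icc a b)) : g.CausalArc (γ a) (γ b) := by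
  have h0 : 0 < b - a := sub_pos.2 hab
  refine ⟨fun t ↦ γ ((b - a) * t + a), (h.comp_affine h0 a).mono fun t ht ↦ ?_, by simp, by simp⟩
  constructor <;> nlinarith [ht.1, ht.2]

lemma IsCausalCurveOn.causal {γ : ℝ → M} {a b : ℝ} (hab : a ≤ b)
    (h : g.IsCausalCurveOn γ (Icc a b)) : g.Causal (γ a) (γ b) := by
  rcases hab.eq_or_lt with rfl | hab
  · exact Or.inl rfl
  · exact Or.inr (h.causalArc hab)

lemma CausalArc.trans {x y z : M} (h₁ : g.CausalArc x y) (h₂ : g.CausalArc y z) :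
    g.CausalArc x z := by
  obtain ⟨γ, hγ, rfl, rfl⟩ := h₁
  obtain ⟨η, hη, h0, rfl⟩ := h₂
  have h1 : g.IsCausalCurveOn (fun t ↦ if t ≤ 1 then γ t else η (t - 1)) (Icc 0 1) :=
    hγ.congr fun t ht ↦ by simp [ht.2]
  have h2 : g.IsCausalCurveOn (fun t ↦ if t ≤ 1 then γ t else η (t - 1)) (Icc 1 2) := by
    have h3 := (hη.comp_affine one_pos (-1)).mono (s' := Icc 1 2) fun t ht ↦ by
      constructor <;> linarith [ht.1, ht.2]
    refine h3.congr fun t ht ↦ ?_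
    rcases ht.1.eq_or_lt with rfl | h
    · simp [h0]
    · simp [h.not_ge, sub_eq_add_neg]
  have := (h1.union zero_le_one one_le_two h2).causalArc two_pos
  norm_num at this
  exact this

lemma Causal.trans {x y z : M} (h₁ : g.Causal x y) (h₂ : g.Causal y z) : g.Causal x z := by
  rcases h₁ with rfl | h₁
  · exact h₂
  rcases h₂ with rfl | h₂
  · exact Or.inr h₁
  · exact Or.inr (CausalArc.trans h₁ h₂)

/-- Infinitely many causal curves can be concatenated into the past. -/
lemma exists_isCausalCurveOn_Iic {z : ℕ → M} (hz : ∀ k, g.CausalArc (z (k + 1)) (z k)) :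
    ∃ γ : ℝ → M, g.IsCausalCurveOn γ (Iic 0) ∧ ∀ k : ℕ, γ (-k) = z k := by
  choose c hc h0 h1 using hz
  -- On `(-(k+1), -k]` the floor is `k` and `γ` runs through `c k`. At `-(k+1)` the value comes from
  -- `c (k+1)` and agrees with `c k 0`.
  set γ : ℝ → M := fun t ↦ c ⌊-t⌋₊ (t + ⌊-t⌋₊ + 1) with hγ
  have hval : ∀ k : ℕ, γ (-k) = z k := fun k ↦ by simp [hγ, h1]
  have hpiece : ∀ k : ℕ, g.IsCausalCurveOn γ (Icc (-(k + 1 : ℝ)) (-k)) := by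
    intro k
    have h3 := ((hc k).comp_affine one_pos (k + 1)).mono (s' := Icc (-(k + 1 : ℝ)) (-k))
      fun t ht ↦ by constructor <;> linarith [ht.1, ht.2]
    refine h3.congr fun t ht ↦ ?_
    rcases ht.1.eq_or_lt with rfl | h
    · have e := hval (k + 1)
      push_cast at e
      rw [e]
      simp [h0]
    · have hf : ⌊-t⌋₊ = k := by
        rw [Nat.floor_eq_iff (by linarith [ht.2, (Nat.cast_nonneg k : (0 : ℝ) ≤ k)])]
        constructor <;> linarith [ht.2]
      simp only [hγ, hf, one_mul, add_assoc]
  have hall : ∀ k : ℕ, g.IsCausalCurveOn γ (Icc (-(k + 1 : ℝ)) 0) := by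
    intro k
    induction k with
    | zero => simpa using hpiece 0
    | succ k ih =>
      have := hpiece (k + 1)
      push_cast at this ⊢
      exact this.union (by linarith) (by linarith [(Nat.cast_nonneg k : (0 : ℝ) ≤ k)]) ih
  have hk : ∀ t : ℝ, ∃ k : ℕ, -(k + 1 : ℝ) < t := fun t ↦ by
    obtain ⟨k, hk⟩ := exists_nat_gt (-t)
    exact ⟨k, by linarith⟩
  have hnh : ∀ t ∈ Iic (0 : ℝ), ∀ k : ℕ, -(k + 1 : ℝ) < t → Icc (-(k + 1 : ℝ)) 0 ∈ 𝓝[Iic 0] t := by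
    intro t _ k hkt
    filter_upwards [self_mem_nhdsWithin, mem_nhdsWithin_of_mem_nhds (Ioi_mem_nhds hkt)]
      with s hs hsb using ⟨hsb.le, hs⟩
  refine ⟨γ, ⟨fun t ht ↦ ?_, fun t ht ↦ ?_, ?_⟩, hval⟩
  · obtain ⟨k, hkt⟩ := hk t
    exact ((hall k).1 t ⟨hkt.le, ht⟩).mono_of_mem_nhdsWithin (hnh t ht k hkt)
  · obtain ⟨k, hkt⟩ := hk t
    obtain ⟨K, u, hu, hK⟩ := (hall k).2.1 t ⟨hkt.le, ht⟩
    exact ⟨K, u, nhdsWithin_le_of_mem (hnh t ht k hkt) hu, hK⟩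
  · filter_upwards [ae_all_iff.2 fun k ↦ (hall k).2.2] with t h ht
    obtain ⟨k, hkt⟩ := hk t
    exact h k ⟨hkt.le, ht⟩

lemma TimelikeSegment.causalArc {x y : M} (h : g.TimelikeSegment x y) : g.CausalArc x y := by
  obtain ⟨γ, hγ, ht, h0, h1⟩ := h
  refine ⟨γ, ⟨hγ.continuousOn, fun t hts ↦ ?_, ?_⟩, h0, h1⟩
  · have h1 : ContMDiffWithinAt 𝓘(ℝ) (𝓡 n) 1 γ (Icc 0 1) t := (hγ t hts).of_le (by norm_cast)
    have h2 : ContMDiffAt (𝓡 n) (𝓡 n) 1 (chartAt (EuclideanSpace ℝ (Fin n)) (γ t)) (γ t) :=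
      contMDiffAt_of_mem_maximalAtlas (IsManifold.chart_mem_maximalAtlas _)
        (mem_chart_source _ _)
    have h3 := (h2.comp_contMDiffWithinAt t h1).contDiffWithinAt
    obtain ⟨K, u, hu, hK⟩ := h3.exists_lipschitzOnWith (convex_Icc 0 1)
    exact ⟨K, u, hu, hK⟩
  · filter_upwards [volume.ae_ne 0, volume.ae_ne 1] with t ht0 ht1 hts
    have hn : Icc (0 : ℝ) 1 ∈ 𝓝 t :=
      Icc_mem_nhds (hts.1.lt_of_ne ht0.symm) (hts.2.lt_of_ne ht1)
    have h := (ht t hts).futureCausal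
    rwa [mfderivWithin_of_mem_nhds hn] at h

lemma Chronological.causalArc {x y : M} (h : g.Chronological x y) : g.CausalArc x y := by
  induction h with
  | single h => exact h.causalArc
  | tail _ h ih => exact ih.trans h.causalArc

lemma Chronological.causal {x y : M} (h : g.Chronological x y) : g.Causal x y :=
  Or.inr h.causalArc

end Spacetime

/-! ### Dictionary between curves in `M` and curves in a cone field. -/

namespace Spacetime

variable {n : ℕ} {M : Type*} [TopologicalSpace M]
  [ChartedSpace (EuclideanSpace ℝ (Fin n)) M] [IsManifold (𝓡 n) ∞ M] {g : Spacetime n M}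

/-- Causal curves are Lipschitz in a chart that varies with the point; working in one fixed chart
requires that `C¹` transition maps preserve this. -/
lemma exists_lipschitzOnWith_chart_change
    {e e' : OpenPartialHomeomorph M (EuclideanSpace ℝ (Fin n))}
    (he : e ∈ atlas (EuclideanSpace ℝ (Fin n)) M) (he' : e' ∈ atlas (EuclideanSpace ℝ (Fin n)) M)
    {γ : ℝ → M} {s : Set ℝ} {t : ℝ} (hγ : ContinuousWithinAt γ s t)
    (ht : γ t ∈ e.source) (ht' : γ t ∈ e'.source)
    (h : ∃ K : NNReal, ∃ u ∈ 𝓝[s] t, LipschitzOnWith K (e ∘ γ) u) :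
    ∃ K : NNReal, ∃ u ∈ 𝓝[s] t, LipschitzOnWith K (e' ∘ γ) u := by
  have hM : IsManifold (𝓡 n) 1 M := .of_le (n := ∞) (by norm_cast)
  obtain ⟨K, u, hu, hK⟩ := h
  have h1 : ContMDiffAt (𝓡 n) (𝓡 n) 1 e.symm (e (γ t)) :=
    contMDiffAt_symm_of_mem_maximalAtlas (IsManifold.subset_maximalAtlas he) (e.map_source ht)
  have h2 : ContMDiffAt (𝓡 n) (𝓡 n) 1 e' (e.symm (e (γ t))) := by
    rw [e.left_inv ht]
    exact contMDiffAt_of_mem_maximalAtlas (IsManifold.subset_maximalAtlas he') ht'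
  obtain ⟨K', w, hw, hK'⟩ := (h2.comp (e (γ t)) h1).contDiffAt.exists_lipschitzOnWith
  have hev1 : ∀ᶠ τ in 𝓝[s] t, γ τ ∈ e.source := hγ (e.open_source.mem_nhds ht)
  have hev2 : ∀ᶠ τ in 𝓝[s] t, e (γ τ) ∈ w :=
    ((e.continuousAt ht).comp_continuousWithinAt hγ) hw
  refine ⟨K' * K, u ∩ {τ | γ τ ∈ e.source ∧ e (γ τ) ∈ w}, inter_mem hu (hev1.and hev2), ?_⟩
  have h3 := hK'.comp (hK.mono (inter_subset_left (t := {τ | γ τ ∈ e.source ∧ e (γ τ) ∈ w})))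
    fun τ hτ ↦ hτ.2.2
  intro x hx y hy
  have := h3 hx hy
  simpa only [Function.comp_apply, e.left_inv hx.2.1, e.left_inv hy.2.1] using this

lemma mdifferentiableAt_chartAt_symm (p : M) {x : EuclideanSpace ℝ (Fin n)}
    (hx : x ∈ (chartAt (EuclideanSpace ℝ (Fin n)) p).target) :
    MDifferentiableAt (𝓡 n) (𝓡 n) (chartAt (EuclideanSpace ℝ (Fin n)) p).symm x :=
  mdifferentiableAt_atlas_symm (chart_mem_atlas _ p) hx

lemma mfderiv_chartAt_symm_comp (p : M) {σ : ℝ → EuclideanSpace ℝ (Fin n)} {t : ℝ}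
    {v : EuclideanSpace ℝ (Fin n)} (hσ : HasDerivAt σ v t)
    (ht : σ t ∈ (chartAt (EuclideanSpace ℝ (Fin n)) p).target) :
    mfderiv 𝓘(ℝ) (𝓡 n) (fun s ↦ (chartAt (EuclideanSpace ℝ (Fin n)) p).symm (σ s)) t (1 : ℝ) =
      chartFrame n p (σ t) v := by
  have h := mfderiv_comp t (I := 𝓘(ℝ)) (I' := 𝓡 n) (I'' := 𝓡 n) (mdifferentiableAt_chartAt_symm p ht)
    hσ.differentiableAt.mdifferentiableAt
  refine (DFunLike.congr_fun h (1 : ℝ)).trans ?_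
  change chartFrame n p (σ t) (mfderiv 𝓘(ℝ) 𝓘(ℝ, EuclideanSpace ℝ (Fin n)) σ t (1 : ℝ)) = _
  congr 1
  rw [mfderiv_eq_fderiv]
  exact hσ.deriv

lemma mfderivWithin_chartAt_symm_comp (p : M) {σ : ℝ → EuclideanSpace ℝ (Fin n)} {s : Set ℝ}
    {t : ℝ} {v : EuclideanSpace ℝ (Fin n)} (hσ : HasDerivWithinAt σ v s t)
    (hs : UniqueDiffWithinAt ℝ s t)
    (ht : σ t ∈ (chartAt (EuclideanSpace ℝ (Fin n)) p).target) :
    mfderivWithin 𝓘(ℝ) (𝓡 n) (fun s ↦ (chartAt (EuclideanSpace ℝ (Fin n)) p).symm (σ s)) s t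
      (1 : ℝ) = chartFrame n p (σ t) v := by
  have h := mfderiv_comp_mfderivWithin t (I := 𝓘(ℝ)) (I' := 𝓡 n) (I'' := 𝓡 n)
    (mdifferentiableAt_chartAt_symm p ht)
    hσ.differentiableWithinAt.mdifferentiableWithinAt hs.uniqueMDiffWithinAt
  refine (DFunLike.congr_fun h (1 : ℝ)).trans ?_
  change chartFrame n p (σ t)
    (mfderivWithin 𝓘(ℝ) 𝓘(ℝ, EuclideanSpace ℝ (Fin n)) σ s t (1 : ℝ)) = _
  congr 1
  rw [mfderivWithin_eq_fderivWithin]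
  exact hσ.derivWithin hs

/-- A ball in the preferred chart at `p` on which the cones of `g` form a Lipschitz cone field. -/
structure ConeChart (g : Spacetime n M) (p : M) where
  /-- The radius of the ball. -/
  r : ℝ
  r_pos : 0 < r
  ball_subset : Metric.closedBall (chartAt (EuclideanSpace ℝ (Fin n)) p p) r ⊆
    (chartAt (EuclideanSpace ℝ (Fin n)) p).target
  /-- The cone field. -/
  F : LipschitzConeField (Metric.closedBall (chartAt (EuclideanSpace ℝ (Fin n)) p p) r)
  futureCausal_iff : ∀ x ∈ Metric.closedBall (chartAt (EuclideanSpace ℝ (Fin n)) p p) r, ∀ v,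
    g.FutureCausal ((chartAt (EuclideanSpace ℝ (Fin n)) p).symm x) (chartFrame n p x v) ↔
      v ∈ F.causal x ∧ v ≠ 0
  futureTimelike_iff : ∀ x ∈ Metric.closedBall (chartAt (EuclideanSpace ℝ (Fin n)) p p) r, ∀ v,
    g.FutureTimelike ((chartAt (EuclideanSpace ℝ (Fin n)) p).symm x) (chartFrame n p x v) ↔
      v ∈ F.timelike x

lemma nonempty_coneChart (g : Spacetime n M) (p : M) : Nonempty (g.ConeChart p) := by
  obtain ⟨r, hr, hsub, F, hF⟩ := g.exists_chart_coneField p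
  exact ⟨⟨r, hr, hsub, F, fun x hx v ↦ (hF x hx v).1, fun x hx v ↦ (hF x hx v).2⟩⟩

namespace ConeChart

variable {p : M} (c : g.ConeChart p)

/-- The domain of the cone field, in coordinates. -/
abbrev K : Set (EuclideanSpace ℝ (Fin n)) :=
  Metric.closedBall (chartAt (EuclideanSpace ℝ (Fin n)) p p) c.r

lemma timelikeSegment_of_chord {x y : EuclideanSpace ℝ (Fin n)} (h : c.F.TimelikeChord x y) :
    g.TimelikeSegment ((chartAt (EuclideanSpace ℝ (Fin n)) p).symm x)
      ((chartAt (EuclideanSpace ℝ (Fin n)) p).symm y) := by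
  set φ := chartAt (EuclideanSpace ℝ (Fin n)) p with hφ
  set σ : ℝ → EuclideanSpace ℝ (Fin n) := fun θ ↦ x + θ • (y - x) with hσ
  have hd : ∀ θ, HasDerivAt σ (y - x) θ := fun θ ↦ by
    have h := ((hasDerivAt_id θ).smul_const (y - x)).const_add x
    rw [one_smul] at h
    exact h
  have hmem : ∀ θ ∈ Icc (0 : ℝ) 1, σ θ ∈ φ.target := fun θ hθ ↦ c.ball_subset (h θ hθ).1
  refine ⟨fun θ ↦ φ.symm (σ θ), ?_, fun θ hθ ↦ ?_, by simp [hσ], by simp [hσ]⟩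
  · have h1 : ContMDiffOn (𝓡 n) (𝓡 n) ∞ φ.symm φ.target := contMDiffOn_chart_symm
    have h2 : ContMDiffOn 𝓘(ℝ) (𝓡 n) ∞ σ (Icc 0 1) := by
      have : ContDiff ℝ ∞ σ := by fun_prop
      exact this.contMDiff.contMDiffOn
    exact h1.comp h2 hmem
  · rw [mfderivWithin_chartAt_symm_comp p (hd θ).hasDerivWithinAt
      (uniqueDiffOn_Icc zero_lt_one θ hθ) (hmem θ hθ)]
    exact (c.futureTimelike_iff _ (h θ hθ).1 _).2 (h θ hθ).2

lemma chronological_of_transGen {x y : EuclideanSpace ℝ (Fin n)}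
    (h : Relation.TransGen c.F.TimelikeChord x y) :
    g.Chronological ((chartAt (EuclideanSpace ℝ (Fin n)) p).symm x)
      ((chartAt (EuclideanSpace ℝ (Fin n)) p).symm y) :=
  Relation.TransGen.lift (p := g.TimelikeSegment) (chartAt (EuclideanSpace ℝ (Fin n)) p).symm
    (fun _ _ h ↦ c.timelikeSegment_of_chord h) _ _ h

/-- Linked points are causally related. -/
lemma causal_of_link {S : Set (EuclideanSpace ℝ (Fin n))} (hS : S ⊆ c.K)
    {a b : EuclideanSpace ℝ (Fin n)} (h : c.F.Link S a b) :
    g.Causal ((chartAt (EuclideanSpace ℝ (Fin n)) p).symm a)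
      ((chartAt (EuclideanSpace ℝ (Fin n)) p).symm b) := by
  have hab := h.ℓ_nonneg
  obtain ⟨σ, hσ0, hσ1, hℓ, hprec⟩ := h
  -- If `ℓ` does not rise, the points coincide. Otherwise `ℓ` of the velocity is `ℓ (b - a) > 0`, so
  -- the velocity is nonzero.
  rcases hab.eq_or_lt with h0 | h0
  · left
    have h1 : c.F.Prec a b := hσ0 ▸ hσ1 ▸ hprec 0 (by simp) 1 (by simp) zero_le_one
    rw [map_sub] at h0
    rw [h1.eq_of_ℓ_eq (hσ0 ▸ hS (hℓ 0 (by simp)).1) (by linarith)]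
  obtain ⟨κ, hκ⟩ := c.F.lipschitzOnWith_of_link hS hℓ hprec hab
  set φ := chartAt (EuclideanSpace ℝ (Fin n)) p with hφ
  have hmem : ∀ t ∈ Icc (0 : ℝ) 1, σ t ∈ φ.target := fun t ht ↦ c.ball_subset (hS (hℓ t ht).1)
  have hcont : ContinuousOn (fun t ↦ φ.symm (σ t)) (Icc 0 1) :=
    φ.continuousOn_symm.comp hκ.continuousOn hmem
  refine Or.inr ⟨fun t ↦ φ.symm (σ t), ⟨hcont, fun t ht ↦ ?_, ?_⟩, congrArg _ hσ0, congrArg _ hσ1⟩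
  · refine exists_lipschitzOnWith_chart_change (chart_mem_atlas _ p) (chart_mem_atlas _ _)
      (hcont t ht) (φ.map_target (hmem t ht)) (mem_chart_source _ _) ⟨κ, Icc 0 1,
        self_mem_nhdsWithin, fun x hx y hy ↦ ?_⟩
    simp only [Function.comp_apply, ← hφ, φ.right_inv (hmem x hx), φ.right_inv (hmem y hy)]
    exact hκ hx hy
  · filter_upwards [hκ.ae_differentiableWithinAt_of_mem_real, volume.ae_ne 0, volume.ae_ne 1]
      with t ht ht0 ht1 hts
    have htI : t ∈ Ioo (0 : ℝ) 1 := ⟨hts.1.lt_of_ne ht0.symm, hts.2.lt_of_ne ht1⟩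
    have hd : HasDerivAt σ (deriv σ t) t :=
      ((ht hts).differentiableAt (Icc_mem_nhds htI.1 htI.2)).hasDerivAt
    obtain ⟨h1, h2⟩ := c.F.mem_causal_of_hasDerivAt hS hℓ hprec htI hd
    rw [mfderiv_chartAt_symm_comp p hd (hmem t hts)]
    refine (c.futureCausal_iff _ (hS (hℓ t hts).1) _).2 ⟨h1, fun h3 ↦ ?_⟩
    rw [h3, map_zero] at h2
    exact h0.ne h2

/-- The endpoints of a causal curve in the domain of the cone chart are linked. -/
lemma link_of_isCausalCurveOn {S : Set (EuclideanSpace ℝ (Fin n))} (hS : S ⊆ c.K) {γ : ℝ → M}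
    {α β : ℝ} (hαβ : α ≤ β) (hγ : g.IsCausalCurveOn γ (Icc α β))
    (hmem : ∀ t ∈ Icc α β, γ t ∈ (chartAt (EuclideanSpace ℝ (Fin n)) p).source ∧
      chartAt (EuclideanSpace ℝ (Fin n)) p (γ t) ∈ S) :
    c.F.Link S (chartAt (EuclideanSpace ℝ (Fin n)) p (γ α))
      (chartAt (EuclideanSpace ℝ (Fin n)) p (γ β)) := by
  set φ := chartAt (EuclideanSpace ℝ (Fin n)) p with hφ
  have hloc : LocallyLipschitzOn (Icc α β) (φ ∘ γ) := fun t ht ↦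
    exists_lipschitzOnWith_chart_change (chart_mem_atlas _ _) (chart_mem_atlas _ p)
      (hγ.1 t ht) (mem_chart_source _ _) (hmem t ht).1 (hγ.2.1 t ht)
  obtain ⟨κ, hκ⟩ := hloc.exists_lipschitzOnWith_of_compact isCompact_Icc
  have hder : ∀ᵐ t, t ∈ Icc α β → ∃ v ∈ c.F.causal (φ (γ t)), HasDerivAt (φ ∘ γ) v t := by
    filter_upwards [hγ.2.2] with t ht hts
    have h1 := ht hts
    have hd := h1.mdifferentiableAt
    have hd2 : MDifferentiableAt 𝓘(ℝ) (𝓡 n) (φ ∘ γ) t :=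
      (mdifferentiableAt_atlas (chart_mem_atlas _ p) (hmem t hts).1).comp t hd
    have hd3 : HasDerivAt (φ ∘ γ) (deriv (φ ∘ γ) t) t := hd2.differentiableAt.hasDerivAt
    have hev : γ =ᶠ[𝓝 t] fun s ↦ φ.symm ((φ ∘ γ) s) := by
      filter_upwards [hd.continuousAt (φ.open_source.mem_nhds (hmem t hts).1)] with s hs
      exact (φ.left_inv hs).symm
    have h2 := h1.congr_of_eventuallyEq hev
    rw [mfderiv_chartAt_symm_comp p hd3 (φ.map_source (hmem t hts).1)] at h2
    exact ⟨_, ((c.futureCausal_iff _ (hS (hmem t hts).2) _).1 h2).1, hd3⟩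
  refine c.F.link_of_curve hS (γ := φ ∘ γ) hαβ hκ.continuousOn (fun u hu ↦ (hmem u hu).2)
    fun s hs t ht hst ↦ ?_
  have hsub : Icc s t ⊆ Icc α β := Icc_subset_Icc hs.1 ht.2
  exact c.F.prec_of_lipschitzOnWith hst (hκ.mono hsub) (fun u hu ↦ hS (hmem u (hsub hu)).2)
    (hder.mono fun u hu hus ↦ hu (hsub hus))

end ConeChart

end Spacetime

lemma LipschitzConeField.link_refl {E : Type*} [NormedAddCommGroup E] [NormedSpace ℝ E] {K : Set E}
    (F : LipschitzConeField K) {S : Set E} (hS : S ⊆ K) {a : E} (ha : a ∈ S) : F.Link S a a :=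
  F.link_of_curve hS (γ := fun _ ↦ a) (le_refl (0 : ℝ)) continuousOn_const (fun _ _ ↦ ha)
    fun _ _ _ _ _ ↦ F.prec_refl (hS ha)

lemma LipschitzConeField.timelikeChord_smul_T {E : Type*} [NormedAddCommGroup E] [NormedSpace ℝ E]
    {K : Set E} (F : LipschitzConeField K) {x : E} {δ : ℝ} (hδ : 0 < δ)
    (hK : ∀ r ∈ Icc 0 δ, x + r • F.T ∈ K) : F.TimelikeChord x (x + δ • F.T) := by
  intro θ hθ
  have h1 : x + θ • (x + δ • F.T - x) = x + (θ * δ) • F.T := by module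
  have h2 : x + δ • F.T - x = 0 + δ • F.T := by module
  have h3 : x + (θ * δ) • F.T ∈ K :=
    hK _ ⟨mul_nonneg hθ.1 hδ.le, mul_le_of_le_one_left hδ.le hθ.2⟩
  rw [h1, h2]
  exact ⟨h3, F.add_smul_T_mem h3 (F.zero_mem h3) hδ⟩

/-! ### Openness of the chronological relation. -/

namespace Spacetime

variable {n : ℕ} {M : Type*} [TopologicalSpace M]
  [ChartedSpace (EuclideanSpace ℝ (Fin n)) M] [IsManifold (𝓡 n) ∞ M] {g : Spacetime n M}

namespace ConeChart

variable {p : M} (c : g.ConeChart p)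

lemma add_smul_T_mem_K {x : EuclideanSpace ℝ (Fin n)}
    (hx : x ∈ Metric.closedBall (chartAt (EuclideanSpace ℝ (Fin n)) p p) (c.r / 2)) :
    ∀ r : ℝ, |r| * (2 * ‖c.F.T‖) ≤ c.r → x + r • c.F.T ∈ c.K := by
  intro r hr
  rw [mem_closedBall_iff_norm] at hx ⊢
  calc ‖x + r • c.F.T - chartAt (EuclideanSpace ℝ (Fin n)) p p‖
      = ‖(x - chartAt (EuclideanSpace ℝ (Fin n)) p p) + r • c.F.T‖ := by congr 1; abel
    _ ≤ c.r / 2 + |r| * ‖c.F.T‖ := by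
      refine (norm_add_le _ _).trans (add_le_add hx ?_)
      rw [norm_smul, Real.norm_eq_abs]
    _ ≤ c.r := by linarith

lemma eventually_abs_mul_le : ∀ᶠ r : ℝ in 𝓝 0, |r| * (2 * ‖c.F.T‖) ≤ c.r := by
  have : Continuous fun r : ℝ ↦ |r| * (2 * ‖c.F.T‖) := by fun_prop
  exact (this.tendsto 0).eventually_le_const (by simpa using c.r_pos)

lemma tendsto_symm_add_smul_T {x : M} (hx : x ∈ (chartAt (EuclideanSpace ℝ (Fin n)) p).source) :
    Tendsto (fun r : ℝ ↦ (chartAt (EuclideanSpace ℝ (Fin n)) p).symm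
      (chartAt (EuclideanSpace ℝ (Fin n)) p x + r • c.F.T)) (𝓝 0) (𝓝 x) := by
  set φ := chartAt (EuclideanSpace ℝ (Fin n)) p
  have h1 : ContinuousAt φ.symm (φ x) := φ.continuousAt_symm (φ.map_source hx)
  have h2 : Tendsto (fun r : ℝ ↦ φ x + r • c.F.T) (𝓝 0) (𝓝 (φ x)) := by
    have : Continuous fun r : ℝ ↦ φ x + r • c.F.T := by fun_prop
    simpa using this.tendsto 0
  have := h1.tendsto.comp h2
  rwa [φ.left_inv hx] at this

end ConeChart

/-- Short segments in the directions `T` and `-T` of a cone chart lead to such points. -/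
lemma exists_chronological_mem_nhds (g : Spacetime n M) (x : M) {U : Set M} (hU : U ∈ 𝓝 x) :
    (∃ y ∈ U, g.Chronological x y) ∧ ∃ y ∈ U, g.Chronological y x := by
  obtain ⟨c⟩ := g.nonempty_coneChart x
  set φ := chartAt (EuclideanSpace ℝ (Fin n)) x with hφ
  have hx : x ∈ φ.source := mem_chart_source _ x
  have hxx : (chartAt (EuclideanSpace ℝ (Fin n)) x).symm (φ x) = x := φ.left_inv hx
  have hev := c.eventually_abs_mul_le.and (c.tendsto_symm_add_smul_T hx hU)
  obtain ⟨ε, hε, hball⟩ := Metric.eventually_nhds_iff_ball.1 hev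
  have hε2 : 0 < ε / 2 := half_pos hε
  have hxS : φ x ∈ Metric.closedBall (φ x) (c.r / 2) :=
    Metric.mem_closedBall_self (half_pos c.r_pos).le
  have hK : ∀ r ∈ Icc (-(ε / 2)) (ε / 2), φ x + r • c.F.T ∈ c.K := fun r hr ↦
    c.add_smul_T_mem_K hxS r (hball r (by
      rw [mem_ball_zero_iff, Real.norm_eq_abs]
      exact (abs_le.2 hr).trans_lt (half_lt_self hε))).1
  constructor
  · refine ⟨φ.symm (φ x + (ε / 2) • c.F.T), (hball (ε / 2) ?_).2, .single ?_⟩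
    · rw [mem_ball_zero_iff, Real.norm_eq_abs, abs_of_pos hε2]
      exact half_lt_self hε
    · have := c.timelikeSegment_of_chord (c.F.timelikeChord_smul_T hε2
        fun r hr ↦ hK r ⟨by linarith [hr.1], hr.2⟩)
      rwa [hxx] at this
  · refine ⟨φ.symm (φ x + (-(ε / 2)) • c.F.T), (hball (-(ε / 2)) ?_).2, .single ?_⟩
    · rw [mem_ball_zero_iff, Real.norm_eq_abs, abs_neg, abs_of_pos hε2]
      exact half_lt_self hε
    · have h1 := c.F.timelikeChord_smul_T (x := φ x + (-(ε / 2)) • c.F.T) hε2 fun r hr ↦ by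
        rw [add_assoc, ← add_smul]
        exact hK _ ⟨by linarith [hr.1], by linarith [hr.2]⟩
      have := c.timelikeSegment_of_chord h1
      rwa [add_assoc, ← add_smul, neg_add_cancel, zero_smul, add_zero, hxx] at this

lemma exists_hasDerivWithinAt_chartAt {γ : ℝ → M}
    (hγ : ContMDiffOn 𝓘(ℝ) (𝓡 n) ∞ γ (Icc 0 1)) {t : ℝ} (ht : t ∈ Icc (0 : ℝ) 1) :
    ∃ v, HasDerivWithinAt (chartAt (EuclideanSpace ℝ (Fin n)) (γ t) ∘ γ) v (Icc 0 1) t ∧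
      mfderivWithin 𝓘(ℝ) (𝓡 n) γ (Icc 0 1) t (1 : ℝ) =
        chartFrame n (γ t) (chartAt (EuclideanSpace ℝ (Fin n)) (γ t) (γ t)) v := by
  set φ := chartAt (EuclideanSpace ℝ (Fin n)) (γ t) with hφ
  have hts : γ t ∈ φ.source := mem_chart_source _ _
  have hd : MDifferentiableWithinAt 𝓘(ℝ) (𝓡 n) γ (Icc 0 1) t :=
    (hγ t ht).mdifferentiableWithinAt (by simp)
  have hd2 : MDifferentiableWithinAt 𝓘(ℝ) (𝓡 n) (φ ∘ γ) (Icc 0 1) t :=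
    (mdifferentiableAt_atlas (chart_mem_atlas _ (γ t)) hts).comp_mdifferentiableWithinAt t hd
  have hd3 := hd2.differentiableWithinAt.hasDerivWithinAt
  have hu := uniqueDiffOn_Icc (zero_lt_one (α := ℝ)) t ht
  refine ⟨_, hd3, ?_⟩
  have h := mfderivWithin_chartAt_symm_comp (γ t) hd3 hu (φ.map_source hts)
  refine Eq.trans ?_ h
  have hev : γ =ᶠ[𝓝[Icc 0 1] t] fun s ↦ φ.symm ((φ ∘ γ) s) := by
    filter_upwards [hd.continuousWithinAt (φ.open_source.mem_nhds hts)] with s hs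
    exact (φ.left_inv hs).symm
  have h2 := hev.mfderivWithin_eq (I := 𝓘(ℝ)) (I' := 𝓡 n) (φ.left_inv hts).symm
  exact DFunLike.congr_fun h2 (1 : ℝ)

/-- Near each of its points, a smooth timelike curve may be replaced by short timelike segments
with one endpoint moved. -/
lemma eventually_timelikeSegment {γ : ℝ → M} (hγ : ContMDiffOn 𝓘(ℝ) (𝓡 n) ∞ γ (Icc 0 1))
    {t₀ : ℝ} (ht₀ : t₀ ∈ Icc (0 : ℝ) 1) (htl : g.FutureTimelike (γ t₀)
      (mfderivWithin 𝓘(ℝ) (𝓡 n) γ (Icc 0 1) t₀ (1 : ℝ))) :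
    ∀ᶠ t in 𝓝[Icc 0 1 \ {t₀}] t₀, ∀ᶠ z in 𝓝 (γ t₀),
      (t₀ < t → g.TimelikeSegment z (γ t)) ∧ (t < t₀ → g.TimelikeSegment (γ t) z) := by
  obtain ⟨v, hv, hvd⟩ := exists_hasDerivWithinAt_chartAt hγ ht₀
  obtain ⟨c⟩ := g.nonempty_coneChart (γ t₀)
  set p := γ t₀ with hp
  set φ := chartAt (EuclideanSpace ℝ (Fin n)) p with hφ
  have hps : p ∈ φ.source := mem_chart_source _ _
  have hpK : φ p ∈ c.K := Metric.mem_closedBall_self c.r_pos.le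
  have hvt : v ∈ c.F.timelike (φ p) := by
    rw [← c.futureTimelike_iff _ hpK]
    exact htl.congr_point (φ.left_inv hps).symm hvd
  -- Being timelike is an open condition on point and vector jointly. A short chord stays in a
  -- convex ball of points, and its slope stays near `v`.
  obtain ⟨ε, hε, hball⟩ := Metric.eventually_nhds_iff_ball.1 (c.F.eventually_timelike hpK hvt)
  set ρ := min ε c.r with hρ
  have hρ0 : 0 < ρ := lt_min hε c.r_pos
  have hBK : Metric.ball (φ p) ρ ⊆ c.K := fun y hy ↦
    Metric.ball_subset_closedBall (Metric.ball_subset_ball (min_le_right _ _) hy)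
  have htime : ∀ y ∈ Metric.ball (φ p) ρ, ∀ w ∈ Metric.ball v ρ, w ∈ c.F.timelike y := by
    intro y hy w hw
    refine hball (y, w) ?_ (hBK hy)
    rw [← ball_prod_same]
    exact ⟨Metric.ball_subset_ball (min_le_left _ _) hy,
      Metric.ball_subset_ball (min_le_left _ _) hw⟩
  have hcont : ContinuousWithinAt γ (Icc 0 1) t₀ := hγ.continuousOn t₀ ht₀
  have hle : 𝓝[Icc 0 1 \ {t₀}] t₀ ≤ 𝓝[Icc 0 1] t₀ := nhdsWithin_mono _ sdiff_subset
  have e1 : ∀ᶠ t in 𝓝[Icc 0 1 \ {t₀}] t₀, γ t ∈ φ.source :=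
    hle (hcont (φ.open_source.mem_nhds hps))
  have e2 : ∀ᶠ t in 𝓝[Icc 0 1 \ {t₀}] t₀, φ (γ t) ∈ Metric.ball (φ p) ρ :=
    hle (((φ.continuousAt hps).comp_continuousWithinAt hcont) (Metric.ball_mem_nhds _ hρ0))
  have e3 : ∀ᶠ t in 𝓝[Icc 0 1 \ {t₀}] t₀,
      (t - t₀)⁻¹ • (φ (γ t) - φ p) ∈ Metric.ball v ρ := by
    have := hasDerivWithinAt_iff_tendsto_slope.1 hv
    exact this (Metric.ball_mem_nhds _ hρ0)
  have e4 : ∀ᶠ t in 𝓝[Icc 0 1 \ {t₀}] t₀, t ∈ Icc (0 : ℝ) 1 \ {t₀} := self_mem_nhdsWithin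
  filter_upwards [e1, e2, e3, e4] with t h1 h2 h3 h4
  -- For fixed `t` the slope condition is open in the other endpoint, so `γ t₀` may be replaced by a
  -- nearby `z`.
  have e5 : ∀ᶠ z in 𝓝 p, (t - t₀)⁻¹ • (φ (γ t) - φ z) ∈ Metric.ball v ρ := by
    have : ContinuousAt (fun z ↦ (t - t₀)⁻¹ • (φ (γ t) - φ z)) p :=
      ((φ.continuousAt hps).const_sub _).const_smul _
    exact this (Metric.isOpen_ball.mem_nhds h3)
  have e6 : ∀ᶠ z in 𝓝 p, φ z ∈ Metric.ball (φ p) ρ :=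
    (φ.continuousAt hps) (Metric.ball_mem_nhds _ hρ0)
  filter_upwards [e5, e6, φ.open_source.mem_nhds hps] with z h5 h6 h7
  constructor
  · intro hlt
    have hpos : 0 < t - t₀ := sub_pos.2 hlt
    have := c.timelikeSegment_of_chord (x := φ z) (y := φ (γ t)) fun θ hθ ↦ by
      have hm := (convex_ball (φ p) ρ).add_smul_sub_mem h6 h2 hθ
      refine ⟨hBK hm, ?_⟩
      have := c.F.smul_mem_timelike (hBK hm) hpos (htime _ hm _ h5)
      rwa [smul_smul, mul_inv_cancel₀ hpos.ne', one_smul] at this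
    rwa [← hφ, φ.left_inv h7, φ.left_inv h1] at this
  · intro hlt
    have hpos : 0 < t₀ - t := sub_pos.2 hlt
    have := c.timelikeSegment_of_chord (x := φ (γ t)) (y := φ z) fun θ hθ ↦ by
      have hm := (convex_ball (φ p) ρ).add_smul_sub_mem h2 h6 hθ
      refine ⟨hBK hm, ?_⟩
      have := c.F.smul_mem_timelike (hBK hm) hpos (htime _ hm _ h5)
      have e : (t₀ - t) • (t - t₀)⁻¹ • (φ (γ t) - φ z) = φ z - φ (γ t) := by
        rw [smul_smul, ← neg_sub t t₀, neg_mul, mul_inv_cancel₀ (sub_ne_zero.2 hlt.ne), neg_smul,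
          one_smul, neg_sub]
      rwa [e] at this
    rwa [← hφ, φ.left_inv h7, φ.left_inv h1] at this

lemma timelikeSegment_restrict {γ : ℝ → M} (hγ : ContMDiffOn 𝓘(ℝ) (𝓡 n) ∞ γ (Icc 0 1))
    (htl : ∀ t ∈ Icc (0 : ℝ) 1, g.FutureTimelike (γ t)
      (mfderivWithin 𝓘(ℝ) (𝓡 n) γ (Icc 0 1) t (1 : ℝ)))
    {a b : ℝ} (ha : 0 ≤ a) (hab : a < b) (hb : b ≤ 1) : g.TimelikeSegment (γ a) (γ b) := by
  have hpos : 0 < b - a := sub_pos.2 hab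
  have hmaps : MapsTo (fun t : ℝ ↦ (b - a) * t + a) (Icc 0 1) (Icc 0 1) := fun t ht ↦ by
    constructor <;> nlinarith [ht.1, ht.2]
  refine ⟨γ ∘ fun t ↦ (b - a) * t + a, ?_, fun t ht ↦ ?_, by simp, by simp⟩
  · refine hγ.comp ?_ hmaps
    have : ContDiff ℝ ∞ fun t : ℝ ↦ (b - a) * t + a := by fun_prop
    exact this.contMDiff.contMDiffOn
  · have hd : HasDerivWithinAt (fun t : ℝ ↦ (b - a) * t + a) (b - a) (Icc 0 1) t := by
      simpa using (((hasDerivAt_id t).const_mul (b - a)).add_const a).hasDerivWithinAt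
    have hu := uniqueDiffOn_Icc (zero_lt_one (α := ℝ)) t ht
    have h := mfderivWithin_comp t (I := 𝓘(ℝ)) (I' := 𝓘(ℝ)) (I'' := 𝓡 n)
      ((hγ _ (hmaps ht)).mdifferentiableWithinAt (by simp))
      hd.differentiableWithinAt.mdifferentiableWithinAt hmaps.subset_preimage hu.uniqueMDiffWithinAt
    have h1 : mfderivWithin 𝓘(ℝ) 𝓘(ℝ) (fun t : ℝ ↦ (b - a) * t + a) (Icc 0 1) t (1 : ℝ) =
        (b - a) * 1 := by
      rw [mfderivWithin_eq_fderivWithin]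
      exact (hd.derivWithin hu).trans (mul_one _).symm
    have h2 := (mfderivWithin 𝓘(ℝ) (𝓡 n) γ (Icc 0 1) ((b - a) * t + a)).map_smul (b - a) (1 : ℝ)
    refine ((htl _ (hmaps ht)).smul hpos).congr_point rfl ?_
    refine h2.symm.trans ?_
    refine Eq.trans ?_ (DFunLike.congr_fun h (1 : ℝ)).symm
    exact congrArg (mfderivWithin 𝓘(ℝ) (𝓡 n) γ (Icc 0 1) ((b - a) * t + a)) h1.symm

/-- Only the beginning of the first segment changes: nearby starting points are joined to `γ t` for
a small `t > 0`, and the rest of the curve is kept. -/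
lemma isOpen_setOf_chronological_left (g : Spacetime n M) (y : M) :
    IsOpen {x | g.Chronological x y} := by
  rw [isOpen_iff_mem_nhds]
  intro x hx
  obtain ⟨u, ⟨γ, hγ, htl, rfl, rfl⟩, huy⟩ := Relation.TransGen.head'_iff.1 hx
  have h := eventually_timelikeSegment hγ (left_mem_Icc.2 zero_le_one)
    (htl 0 (left_mem_Icc.2 zero_le_one))
  have hle : 𝓝[Ioo (0 : ℝ) 1] 0 ≤ 𝓝[Icc 0 1 \ {0}] 0 := nhdsWithin_mono _ fun t ht ↦
    ⟨Ioo_subset_Icc_self ht, ht.1.ne'⟩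
  have : (𝓝[Ioo (0 : ℝ) 1] 0).NeBot := left_nhdsWithin_Ioo_neBot zero_lt_one
  obtain ⟨t, ht, ht'⟩ := ((h.filter_mono hle).and self_mem_nhdsWithin).exists
  filter_upwards [ht] with z hz
  exact Relation.TransGen.head (hz.1 ht'.1) (Relation.TransGen.head'
    (timelikeSegment_restrict hγ htl ht'.1.le ht'.2 le_rfl) huy)

lemma isOpen_setOf_chronological_right (g : Spacetime n M) (x : M) :
    IsOpen {y | g.Chronological x y} := by
  rw [isOpen_iff_mem_nhds]
  intro y hy
  obtain ⟨u, hxu, ⟨γ, hγ, htl, rfl, rfl⟩⟩ := Relation.TransGen.tail'_iff.1 hy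
  have h := eventually_timelikeSegment hγ (right_mem_Icc.2 zero_le_one)
    (htl 1 (right_mem_Icc.2 zero_le_one))
  have hle : 𝓝[Ioo (0 : ℝ) 1] 1 ≤ 𝓝[Icc 0 1 \ {1}] 1 := nhdsWithin_mono _ fun t ht ↦
    ⟨Ioo_subset_Icc_self ht, ht.2.ne⟩
  have : (𝓝[Ioo (0 : ℝ) 1] 1).NeBot := right_nhdsWithin_Ioo_neBot zero_lt_one
  obtain ⟨t, ht, ht'⟩ := ((h.filter_mono hle).and self_mem_nhdsWithin).exists
  filter_upwards [ht] with z hz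
  exact Relation.TransGen.tail (Relation.TransGen.tail' hxu
    (timelikeSegment_restrict hγ htl le_rfl ht'.1 ht'.2.le)) (hz.2 ht'.2)

end Spacetime

/-! ### Push-up and limits of causal curves in `M`. -/

namespace Spacetime

variable {n : ℕ} {M : Type*} [TopologicalSpace M]
  [ChartedSpace (EuclideanSpace ℝ (Fin n)) M] [IsManifold (𝓡 n) ∞ M] {g : Spacetime n M}

/-- Push-up for causal curves in a small neighbourhood. -/
lemma exists_nhds_push_up (g : Spacetime n M) (p : M) :
    ∃ N : Set M, IsOpen N ∧ p ∈ N ∧ ∀ (γ : ℝ → M) (a b : ℝ), a ≤ b →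
      g.IsCausalCurveOn γ (Icc a b) → (∀ t ∈ Icc a b, γ t ∈ N) →
      (∀ z, g.Chronological (γ b) z → g.Chronological (γ a) z) ∧
      (∀ z, g.Chronological z (γ a) → g.Chronological z (γ b)) := by
  obtain ⟨c⟩ := g.nonempty_coneChart p
  set φ := chartAt (EuclideanSpace ℝ (Fin n)) p with hφ
  have hp : p ∈ φ.source := mem_chart_source _ p
  have hr2 : 0 < c.r / 2 := half_pos c.r_pos
  refine ⟨φ.source ∩ φ ⁻¹' Metric.ball (φ p) (c.r / 2),
    φ.isOpen_inter_preimage Metric.isOpen_ball, ⟨hp, Metric.mem_ball_self hr2⟩, ?_⟩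
  intro γ a b hab hγ hN
  set S := Metric.closedBall (φ p) (c.r / 2) with hS
  have hSK : S ⊆ c.K := Metric.closedBall_subset_closedBall (half_le_self c.r_pos.le)
  have hlink := c.link_of_isCausalCurveOn hSK hab hγ fun t ht ↦
    ⟨(hN t ht).1, Metric.ball_subset_closedBall (hN t ht).2⟩
  have hK : ∀ δ : ℝ, 0 < δ → |δ| * (2 * ‖c.F.T‖) ≤ c.r →
      ∀ x ∈ S, ∀ r ∈ Icc (-δ) δ, x + r • c.F.T ∈ c.K := by
    intro δ hδ hle x hx r hr
    refine c.add_smul_T_mem_K hx r (le_trans ?_ hle)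
    rw [abs_of_pos hδ]
    gcongr
    exact abs_le.2 hr
  have ha : γ a ∈ φ.source := (hN a (left_mem_Icc.2 hab)).1
  have hb : γ b ∈ φ.source := (hN b (right_mem_Icc.2 hab)).1
  have haa : (chartAt (EuclideanSpace ℝ (Fin n)) p).symm (φ (γ a)) = γ a := φ.left_inv ha
  have hbb : (chartAt (EuclideanSpace ℝ (Fin n)) p).symm (φ (γ b)) = γ b := φ.left_inv hb
  constructor
  · intro z hz
    -- The past of `z` is open, so `γ b` can be raised by `δ • T` inside it. The tilt with `c = 0`
    -- fixes `γ a` and ends at the raised point.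
    have hev := (c.eventually_abs_mul_le.and (c.tendsto_symm_add_smul_T hb
      ((g.isOpen_setOf_chronological_left z).mem_nhds hz))).filter_mono
      (nhdsWithin_le_nhds (s := Ioi 0))
    obtain ⟨δ, ⟨h1, h2⟩, hδ⟩ := (hev.and self_mem_nhdsWithin).exists
    have h := c.chronological_of_transGen (c.F.transGen_timelikeChord_of_link
      (convex_closedBall _ _) hSK hlink hδ (c := 0) (by simp) (hK δ hδ h1))
    rw [mul_zero, zero_smul, add_zero, add_zero, mul_one, haa] at h
    exact Relation.TransGen.trans h h2
  · intro z hz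
    have hneg : Tendsto (fun r : ℝ ↦ -r) (𝓝 0) (𝓝 0) := by
      simpa using (continuous_neg (G := ℝ)).tendsto 0
    -- Dually, `γ a` is lowered, and the tilt with `c = -1` fixes `γ b`.
    have hev := (c.eventually_abs_mul_le.and ((c.tendsto_symm_add_smul_T ha).comp hneg
      ((g.isOpen_setOf_chronological_right z).mem_nhds hz))).filter_mono
      (nhdsWithin_le_nhds (s := Ioi 0))
    obtain ⟨δ, ⟨h1, h2⟩, hδ⟩ := (hev.and self_mem_nhdsWithin).exists
    have h := c.chronological_of_transGen (c.F.transGen_timelikeChord_of_link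
      (convex_closedBall _ _) hSK hlink hδ (c := -1) (by simp) (hK δ hδ h1))
    rw [mul_neg_one, add_neg_cancel, mul_zero, zero_smul, add_zero, hbb] at h
    exact Relation.TransGen.trans h2 h

/-- By compactness the curve splits into finitely many arcs, each in a push-up neighbourhood, and
the transfers along the arcs compose. -/
lemma CausalArc.push_up {x y : M} (h : g.CausalArc x y) :
    (∀ z, g.Chronological y z → g.Chronological x z) ∧
    (∀ z, g.Chronological z x → g.Chronological z y) := by
  obtain ⟨γ, hγ, rfl, rfl⟩ := h
  choose N hNo hpN hN using g.exists_nhds_push_up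
  have hcont : Continuous ((Icc (0 : ℝ) 1).domRestrict γ) :=
    continuousOn_iff_continuous_domRestrict.1 hγ.1
  obtain ⟨t, ht0, hmono, ⟨m, hm⟩, hsub⟩ := exists_monotone_Icc_subset_open_cover_Icc
    (zero_le_one (α := ℝ)) (c := fun p : M ↦ (Icc (0 : ℝ) 1).domRestrict γ ⁻¹' N p)
    (fun p ↦ (hNo p).preimage hcont) fun s _ ↦ mem_iUnion.2 ⟨γ s, hpN _⟩
  have hstep : ∀ k, (∀ z, g.Chronological (γ (t (k + 1))) z → g.Chronological (γ (t k)) z) ∧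
      (∀ z, g.Chronological z (γ (t k)) → g.Chronological z (γ (t (k + 1)))) := by
    intro k
    obtain ⟨p, hp⟩ := hsub k
    refine hN p γ (t k) (t (k + 1)) (hmono (Nat.le_succ k))
      (hγ.mono (Icc_subset_Icc (t k).2.1 (t (k + 1)).2.2)) fun s hs ↦ ?_
    exact @hp ⟨s, (t k).2.1.trans hs.1, hs.2.trans (t (k + 1)).2.2⟩ ⟨hs.1, hs.2⟩
  have hall : ∀ k, (∀ z, g.Chronological (γ (t k)) z → g.Chronological (γ 0) z) ∧
      (∀ z, g.Chronological z (γ 0) → g.Chronological z (γ (t k))) := by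
    intro k
    induction k with
    | zero => rw [ht0]; exact ⟨fun _ h ↦ h, fun _ h ↦ h⟩
    | succ k ih =>
      exact ⟨fun z hz ↦ ih.1 z ((hstep k).1 z hz), fun z hz ↦ (hstep k).2 z (ih.2 z hz)⟩
  have := hall m
  rwa [hm m le_rfl] at this

lemma Causal.trans_chronological {x y z : M} (h : g.Causal x y) (h' : g.Chronological y z) :
    g.Chronological x z := by
  rcases h with rfl | h
  · exact h'
  · exact (CausalArc.push_up h).1 z h'

lemma Chronological.trans_causal {x y z : M} (h : g.Chronological x y) (h' : g.Causal y z) :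
    g.Chronological x z := by
  rcases h' with rfl | h'
  · exact h
  · exact (CausalArc.push_up h').2 x h

/-- Limits of causal curves near a point: along an ultrafilter, the past endpoints `x i` either
converge to a point in the causal past of the limit of the future endpoints, or the curves leave a
neighbourhood of the point through points that converge. -/
lemma exists_nhds_limit_alternative [T2Space M] (g : Spacetime n M) (p : M) :
    ∃ N : Set M, IsOpen N ∧ p ∈ N ∧ ∀ {ι : Type*} (𝒰 : Ultrafilter ι) (x w : ι → M) (z : M),
      z ∈ N → Tendsto w 𝒰 (𝓝 z) → (∀ᶠ i in (𝒰 : Filter ι), g.Causal (x i) (w i)) →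
      (∃ x', Tendsto x 𝒰 (𝓝 x') ∧ g.Causal x' z) ∨
      ∃ z' ∉ N, g.Causal z' z ∧ ∃ w' : ι → M, Tendsto w' 𝒰 (𝓝 z') ∧
        ∀ᶠ i in (𝒰 : Filter ι), g.Causal (x i) (w' i) := by
  obtain ⟨c⟩ := g.nonempty_coneChart p
  set φ := chartAt (EuclideanSpace ℝ (Fin n)) p with hφ
  have hp : p ∈ φ.source := mem_chart_source _ p
  set N := φ.source ∩ φ ⁻¹' Metric.ball (φ p) c.r with hN
  have hNo : IsOpen N := φ.isOpen_inter_preimage Metric.isOpen_ball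
  set B := φ.symm '' c.K with hB
  have hKc : IsCompact c.K := isCompact_closedBall _ _
  have hBclosed : IsClosed B :=
    (hKc.image_of_continuousOn (φ.continuousOn_symm.mono c.ball_subset)).isClosed
  have hBmem : ∀ y, y ∈ B ↔ y ∈ φ.source ∧ φ y ∈ c.K := by
    intro y
    constructor
    · rintro ⟨u, hu, rfl⟩
      refine ⟨φ.map_target (c.ball_subset hu), ?_⟩
      rwa [φ.right_inv (c.ball_subset hu)]
    · rintro ⟨h1, h2⟩
      exact ⟨φ y, h2, φ.left_inv h1⟩
  have hNB : N ⊆ B := fun y hy ↦ (hBmem y).2 ⟨hy.1, Metric.ball_subset_closedBall hy.2⟩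
  refine ⟨N, hNo, ⟨hp, Metric.mem_ball_self c.r_pos⟩, ?_⟩
  intro ι 𝒰 x w z hz hw hxw
  -- Going back from `b`, the curve is cut at its last parameter outside `N`; the remaining arc lies
  -- in the compact set `B`. If there is none, the cut is at `a`.
  have hexit : ∀ a b : M, b ∈ N → g.Causal a b → ∃ w' ∈ B, g.Causal a w' ∧
      c.F.Link c.K (φ w') (φ b) ∧ (w' = a ∨ w' ∉ N) := by
    intro a b hb hab
    rcases hab with rfl | ⟨γ, hγ, rfl, rfl⟩
    · exact ⟨a, hNB hb, Or.inl rfl, c.F.link_refl le_rfl ((hBmem a).1 (hNB hb)).2, Or.inl rfl⟩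
    have hcpt : IsCompact {t ∈ Icc (0 : ℝ) 1 | γ t ∈ Nᶜ} :=
      isCompact_Icc.of_isClosed_subset
        (hγ.1.preimage_isClosed_of_isClosed isClosed_Icc hNo.isClosed_compl) inter_subset_left
    by_cases hne : {t ∈ Icc (0 : ℝ) 1 | γ t ∈ Nᶜ}.Nonempty
    · obtain ⟨s, ⟨hs, hsN⟩, hmax⟩ := hcpt.exists_isGreatest hne
      have hs1 : s < 1 := hs.2.lt_of_ne (by rintro rfl; exact hsN hb)
      have hafter : ∀ t ∈ Ioc s 1, γ t ∈ N := by
        intro t ht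
        by_contra h
        exact ht.1.not_ge (hmax ⟨⟨hs.1.trans ht.1.le, ht.2⟩, h⟩)
      have hsB : γ s ∈ B := by
        have h1 : Tendsto γ (𝓝[Ioc s 1] s) (𝓝 (γ s)) :=
          ((hγ.1 s hs).mono fun t ht ↦ ⟨hs.1.trans ht.1.le, ht.2⟩)
        have : (𝓝[Ioc s 1] s).NeBot := left_nhdsWithin_Ioc_neBot hs1
        exact hBclosed.mem_of_tendsto h1
          (eventually_nhdsWithin_of_forall fun t ht ↦ hNB (hafter t ht))
      refine ⟨γ s, hsB, (hγ.mono (Icc_subset_Icc le_rfl hs.2)).causal hs.1, ?_, Or.inr hsN⟩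
      refine c.link_of_isCausalCurveOn le_rfl hs1.le (hγ.mono (Icc_subset_Icc hs.1 le_rfl))
        fun t ht ↦ (hBmem _).1 ?_
      rcases ht.1.eq_or_lt with rfl | h
      · exact hsB
      · exact hNB (hafter t ⟨h, ht.2⟩)
    · have hall : ∀ t ∈ Icc (0 : ℝ) 1, γ t ∈ N := by
        intro t ht
        by_contra h
        exact hne ⟨t, ht, h⟩
      exact ⟨γ 0, hNB (hall 0 (by simp)), Or.inl rfl, c.link_of_isCausalCurveOn le_rfl zero_le_one
        hγ fun t ht ↦ (hBmem _).1 (hNB (hall t ht)), Or.inl rfl⟩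
  have hall : ∀ i, ∃ w', w i ∈ N → g.Causal (x i) (w i) → w' ∈ B ∧ g.Causal (x i) w' ∧
      c.F.Link c.K (φ w') (φ (w i)) ∧ (w' = x i ∨ w' ∉ N) := by
    intro i
    by_cases h : w i ∈ N ∧ g.Causal (x i) (w i)
    · obtain ⟨w', h'⟩ := hexit _ _ h.1 h.2
      exact ⟨w', fun _ _ ↦ h'⟩
    · exact ⟨p, fun h1 h2 ↦ absurd ⟨h1, h2⟩ h⟩
  choose w' hw' using hall
  have hev : ∀ᶠ i in (𝒰 : Filter ι), w' i ∈ B ∧ g.Causal (x i) (w' i) ∧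
      c.F.Link c.K (φ (w' i)) (φ (w i)) ∧ (w' i = x i ∨ w' i ∉ N) := by
    filter_upwards [hw (hNo.mem_nhds hz), hxw] with i h1 h2 using hw' i h1 h2
  obtain ⟨y, hyK, hy⟩ := hKc.ultrafilter_le_nhds' (𝒰.map fun i ↦ φ (w' i))
    (hev.mono fun i hi ↦ ((hBmem _).1 hi.1).2)
  have hyt : Tendsto (fun i ↦ φ (w' i)) 𝒰 (𝓝 y) := hy
  have hzt : Tendsto (fun i ↦ φ (w i)) 𝒰 (𝓝 (φ z)) := (φ.continuousAt hz.1).tendsto.comp hw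
  have hlink := c.F.link_of_tendsto hKc le_rfl hyt hzt (hev.mono fun i hi ↦ hi.2.2.1)
  have hcausal := c.causal_of_link le_rfl hlink
  have hzz : (chartAt (EuclideanSpace ℝ (Fin n)) p).symm (φ z) = z := φ.left_inv hz.1
  rw [hzz] at hcausal
  have hw't : Tendsto w' 𝒰 (𝓝 (φ.symm y)) := by
    have h1 := (φ.continuousAt_symm (c.ball_subset hyK)).tendsto.comp hyt
    refine h1.congr' (hev.mono fun i hi ↦ φ.left_inv ((hBmem _).1 hi.1).1)
  -- The ultrafilter decides whether the curves end in `N` or leave it.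
  rcases Ultrafilter.eventually_or.1 (hev.mono fun i hi ↦ hi.2.2.2) with h | h
  · exact Or.inl ⟨_, hw't.congr' h, hcausal⟩
  · exact Or.inr ⟨_, hNo.isClosed_compl.mem_of_tendsto hw't h, hcausal, w', hw't,
      hev.mono fun i hi ↦ hi.2.1⟩

end Spacetime

namespace Spacetime

variable {n : ℕ} {M : Type*} [TopologicalSpace M]
  [ChartedSpace (EuclideanSpace ℝ (Fin n)) M] [IsManifold (𝓡 n) ∞ M] {g : Spacetime n M}

/-! ### Positivity of the cosmological volume function. -/

section Volume

/-- A kernel vector would be orthogonal to everything. Being orthogonal to the negative vector in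
the signature, it would have positive square, yet it is orthogonal to itself. -/
lemma det_gram_chartAt_ne_zero (g : Spacetime n M) (p : M) :
    (g.gram (chartAt (EuclideanSpace ℝ (Fin n)) p)
      (chartAt (EuclideanSpace ℝ (Fin n)) p p)).det ≠ 0 := by
  intro h
  obtain ⟨v, hv, hmul⟩ := Matrix.exists_mulVec_eq_zero_iff.2 h
  set x := chartAt (EuclideanSpace ℝ (Fin n)) p p
  set V : EuclideanSpace ℝ (Fin n) := WithLp.toLp 2 v with hV
  have hVne : V ≠ 0 := fun h0 ↦ hv (by
    have := congrArg WithLp.ofLp h0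
    simpa [hV] using this)
  have hsum : ∀ u : EuclideanSpace ℝ (Fin n), u = ∑ i, u i • EuclideanSpace.single i (1 : ℝ) := by
    intro u
    have := (EuclideanSpace.basisFun (Fin n) ℝ).sum_repr u
    simpa using this.symm
  have h0 : ∀ i, g.coordMetric p x (EuclideanSpace.single i 1) V = 0 := by
    intro i
    have h1 := congrFun hmul i
    rw [hsum V, map_sum]
    simp only [map_smul, smul_eq_mul]
    rw [← h1.trans (Pi.zero_apply i)]
    simp only [Matrix.mulVec, dotProduct]
    exact Finset.sum_congr rfl fun j _ ↦ mul_comm _ _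
  have h1 : ∀ u, g.coordMetric p x u V = 0 := by
    intro u
    rw [hsum u, map_sum, sum_apply]
    exact Finset.sum_eq_zero fun i _ ↦ by rw [map_smul, smul_apply, h0, smul_zero]
  obtain ⟨T, -, hT⟩ := g.coordMetric_signature p
  have := hT V (h1 T) hVne
  rw [h1 V] at this
  exact this.false

variable [MeasurableSpace M]

lemma Chronological.cosmologicalVolume_le {x y : M} (h : g.Chronological x y) :
    g.cosmologicalVolume x ≤ g.cosmologicalVolume y :=
  measure_mono fun _ hz ↦ Relation.TransGen.trans hz h

variable [BorelSpace M]

/-- By continuity the volume density is bounded below by a positive constant on a small coordinate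
ball. -/
lemma vol_pos_of_isOpen (g : Spacetime n M) {U : Set M} (hU : IsOpen U) (hne : U.Nonempty) :
    0 < g.vol U := by
  obtain ⟨p, hp⟩ := hne
  set φ := chartAt (EuclideanSpace ℝ (Fin n)) p with hφ
  have hps : p ∈ φ.source := mem_chart_source _ p
  have hcG : ContinuousAt (g.coordMetric p) (φ p) := (g.contDiffAt_coordMetric p).continuousAt
  have hcont : ContinuousAt (fun y ↦ Real.sqrt |(g.gram φ y).det|) (φ p) := by
    have h1 : ContinuousAt (fun y ↦ g.gram φ y) (φ p) := by
      refine continuousAt_pi.2 fun i ↦ continuousAt_pi.2 fun j ↦ ?_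
      exact (hcG.clm_apply continuousAt_const).clm_apply continuousAt_const
    have h2 : Continuous fun A : Matrix (Fin n) (Fin n) ℝ ↦ Real.sqrt |A.det| := by fun_prop
    exact h2.continuousAt.comp h1
  obtain ⟨c, hc0, hc⟩ : ∃ c, 0 < c ∧ c < Real.sqrt |(g.gram φ (φ p)).det| :=
    exists_between (Real.sqrt_pos.2 (abs_pos.2 (g.det_gram_chartAt_ne_zero p)))
  have hV : φ.target ∩ φ.symm ⁻¹' U ∈ 𝓝 (φ p) := by
    refine (φ.isOpen_inter_preimage_symm hU).mem_nhds ⟨φ.map_source hps, ?_⟩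
    simpa [φ.left_inv hps] using hp
  obtain ⟨ε, hε, hball⟩ := Metric.nhds_basis_ball.mem_iff.1
    (inter_mem hV (hcont.eventually_const_lt hc))
  have hsub : Metric.ball (φ p) ε ⊆ φ '' (U ∩ φ.source) := fun y hy ↦
    ⟨φ.symm y, ⟨(hball hy).1.2, φ.map_target (hball hy).1.1⟩, φ.right_inv (hball hy).1.1⟩
  refine lt_of_lt_of_le ?_ (measure_mono (inter_subset_left (s := U) (t := φ.source)))
  rw [g.vol_apply (chart_mem_atlas _ p) (hU.inter φ.open_source).measurableSet inter_subset_right]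
  calc 0 < ENNReal.ofReal c * volume (Metric.ball (φ p) ε) :=
        ENNReal.mul_pos (ENNReal.ofReal_pos.2 hc0).ne' (Metric.measure_ball_pos _ _ hε).ne'
    _ = ∫⁻ _ in Metric.ball (φ p) ε, ENNReal.ofReal c := (setLIntegral_const _ _).symm
    _ ≤ ∫⁻ y in Metric.ball (φ p) ε, ENNReal.ofReal (Real.sqrt |(g.gram φ y).det|) :=
        setLIntegral_mono' Metric.isOpen_ball.measurableSet fun y hy ↦
          ENNReal.ofReal_le_ofReal (le_of_lt (hball hy).2)
    _ ≤ _ := lintegral_mono_set hsub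

lemma cosmologicalVolume_pos (g : Spacetime n M) (x : M) : 0 < g.cosmologicalVolume x := by
  obtain ⟨y, -, hy⟩ := (g.exists_chronological_mem_nhds x univ_mem).2
  exact g.vol_pos_of_isOpen (g.isOpen_setOf_chronological_left x) ⟨y, hy⟩

end Volume

/-! ### Consequences of regularity. -/

section Regular

variable [T2Space M] [SecondCountableTopology M] [MeasurableSpace M] [BorelSpace M]

lemma metrizableSpace_of_chartedSpace (n : ℕ) (M : Type*) [TopologicalSpace M] [T2Space M]
    [SecondCountableTopology M] [ChartedSpace (EuclideanSpace ℝ (Fin n)) M] :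
    TopologicalSpace.MetrizableSpace M := by
  have := ChartedSpace.locallyCompactSpace (EuclideanSpace ℝ (Fin n)) M
  exact TopologicalSpace.metrizableSpace_of_t3_secondCountable M

/-- A past-directed causal sequence whose chronological future stays in the future of a fixed
point converges. -/
theorem HasRegularCosmologicalVolume.exists_tendsto (hτ : g.HasRegularCosmologicalVolume)
    {z : ℕ → M} (hz : ∀ k, g.Causal (z (k + 1)) (z k)) {p : M}
    (hp : ∀ k y, g.Chronological (z k) y → g.Chronological p y) :
    ∃ x, Tendsto z atTop (𝓝 x) := by
  have := metrizableSpace_of_chartedSpace n M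
  let _ := TopologicalSpace.metrizableSpaceMetric M
  -- Since `z (k + 1) ≤ z k` may be an equality, realized by no curve, the sequence is replaced by a
  -- chain `y (k + 1) ≪ y k` with `z k ≪ y k` at distance less than `1 / (k + 1)`.
  have hstart : ∃ y, g.Chronological (z 0) y ∧ dist y (z 0) < 1 / ((0 : ℕ) + 1) := by
    obtain ⟨y, hy, h⟩ := (g.exists_chronological_mem_nhds (z 0)
      (Metric.ball_mem_nhds (z 0) (ε := 1 / ((0 : ℕ) + 1)) (by positivity))).1
    exact ⟨y, h, hy⟩
  have hstep : ∀ (k : ℕ) (y : M), ∃ y', g.Chronological (z k) y → g.Chronological (z (k + 1)) y' ∧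
      g.Chronological y' y ∧ dist y' (z (k + 1)) < 1 / ((k + 1 : ℕ) + 1) := by
    intro k y
    by_cases hy : g.Chronological (z k) y
    · have h1 : g.Chronological (z (k + 1)) y := (hz k).trans_chronological hy
      obtain ⟨y', hy', h⟩ := (g.exists_chronological_mem_nhds (z (k + 1)) (inter_mem
        ((g.isOpen_setOf_chronological_left y).mem_nhds h1)
        (Metric.ball_mem_nhds (z (k + 1)) (ε := 1 / ((k + 1 : ℕ) + 1)) (by positivity)))).1
      exact ⟨y', fun _ ↦ ⟨h, hy'.1, hy'.2⟩⟩
    · exact ⟨y, fun h ↦ absurd h hy⟩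
  obtain ⟨y₀, hy₀, hd₀⟩ := hstart
  choose f hf using hstep
  set y : ℕ → M := fun k ↦ Nat.rec y₀ (fun k y ↦ f k y) k with hy
  have hyz : ∀ k, g.Chronological (z k) (y k) ∧ dist (y k) (z k) < 1 / ((k : ℝ) + 1) := by
    intro k
    induction k with
    | zero => exact ⟨hy₀, hd₀⟩
    | succ k ih => exact ⟨(hf k _ ih.1).1, (hf k _ ih.1).2.2⟩
  have hyy : ∀ k, g.Chronological (y (k + 1)) (y k) := fun k ↦ (hf k _ (hyz k).1).2.1
  obtain ⟨γ, hγ, hγy⟩ := exists_isCausalCurveOn_Iic fun k ↦ (hyy k).causalArc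
  have hbot : Tendsto (fun k : ℕ ↦ -(k : ℝ)) atTop atBot :=
    tendsto_neg_atTop_atBot.comp tendsto_natCast_atTop_atTop
  by_contra hnot
  -- A past limit of `γ` would be a limit of `y`, hence of `z`.
  have hinext : g.IsPastInextendible γ := by
    refine ⟨hγ, fun ⟨x, hx⟩ ↦ hnot ⟨x, ?_⟩⟩
    have h1 : Tendsto y atTop (𝓝 x) := (hx.comp hbot).congr fun k ↦ hγy k
    refine h1.congr_dist (squeeze_zero (fun _ ↦ dist_nonneg) (fun k ↦ (hyz k).2.le) ?_)
    exact tendsto_one_div_add_atTop_nhds_zero_nat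
  have h0 : Tendsto (fun k ↦ g.cosmologicalVolume (y k)) atTop (𝓝 0) :=
    ((hτ.2 γ hinext).comp hbot).congr fun k ↦ by simp [hγy]
  have h1 : g.cosmologicalVolume p ≤ 0 :=
    ge_of_tendsto h0 (Eventually.of_forall fun k ↦ (hp k _ (hyz k).1).cosmologicalVolume_le)
  exact (g.cosmologicalVolume_pos p).not_ge h1

/-- The alternating sequence `x, y, x, y, …` is past-directed causal, and its chronological futures
lie in that of any `p ≪ x`; so it converges. -/
theorem HasRegularCosmologicalVolume.causal_antisymm (hτ : g.HasRegularCosmologicalVolume)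
    {x y : M} (hxy : g.Causal x y) (hyx : g.Causal y x) : x = y := by
  obtain ⟨p, -, hp⟩ := (g.exists_chronological_mem_nhds x univ_mem).2
  set z : ℕ → M := fun k ↦ if Even k then x else y with hz
  obtain ⟨w, hw⟩ := hτ.exists_tendsto (z := z) (p := p) (fun k ↦ by
      by_cases h : Even k
      · simpa [hz, h, Nat.even_add_one] using hyx
      · simpa [hz, h, Nat.even_add_one] using hxy) (fun k u hu ↦ by
      by_cases h : Even k
      · simp only [hz, h, if_true] at hu
        exact Relation.TransGen.trans hp hu
      · simp only [hz, h, if_false] at hu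
        exact Relation.TransGen.trans hp (hxy.trans_chronological hu))
  have he : Tendsto (fun k : ℕ ↦ 2 * k) atTop atTop :=
    tendsto_id.const_mul_atTop' two_pos
  have ho : Tendsto (fun k : ℕ ↦ 2 * k + 1) atTop atTop := (tendsto_add_atTop_nat 1).comp he
  have h1 : x = w := tendsto_nhds_unique (tendsto_const_nhds.congr fun k ↦ by simp [hz]) (hw.comp he)
  have h2 : y = w := tendsto_nhds_unique
    (tendsto_const_nhds.congr fun k ↦ by simp [hz]) (hw.comp ho)
  rw [h1, h2]

/-- Limits of causal relations with past endpoints in the future of a fixed point. -/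
theorem HasRegularCosmologicalVolume.exists_tendsto_causal (hτ : g.HasRegularCosmologicalVolume)
    {ι : Type*} (𝒰 : Ultrafilter ι) {x w : ι → M} {p y : M} (hw : Tendsto w 𝒰 (𝓝 y))
    (hxw : ∀ᶠ i in (𝒰 : Filter ι), g.Causal (x i) (w i))
    (hpx : ∀ᶠ i in (𝒰 : Filter ι), g.Causal p (x i)) :
    ∃ x', Tendsto x 𝒰 (𝓝 x') ∧ g.Causal x' y := by
  have := metrizableSpace_of_chartedSpace n M
  let _ := TopologicalSpace.metrizableSpaceMetric M
  by_contra hnot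
  -- Points reached while following the limit curves from `y` into the past.
  let P : M → Prop := fun z ↦ g.Causal z y ∧
    ∃ w' : ι → M, Tendsto w' 𝒰 (𝓝 z) ∧ ∀ᶠ i in (𝒰 : Filter ι), g.Causal (x i) (w' i)
  have hstep : ∀ z, ∃ N : Set M, IsOpen N ∧ z ∈ N ∧ ∀ u ∈ N, P u → ∃ u' ∉ N, g.Causal u' u ∧ P u' := by
    intro z
    obtain ⟨N, hNo, hzN, hN⟩ := g.exists_nhds_limit_alternative z
    refine ⟨N, hNo, hzN, fun u hu hPu ↦ ?_⟩
    obtain ⟨huy, w', hw', hxw'⟩ := hPu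
    rcases hN 𝒰 x w' u hu hw' hxw' with ⟨x', hx', hx'u⟩ | ⟨u', hu', hu'u, w'', hw'', hxw''⟩
    · exact absurd ⟨x', hx', hx'u.trans huy⟩ hnot
    · exact ⟨u', hu', hu'u, hu'u.trans huy, w'', hw'', hxw''⟩
  -- `Q z m` allows a step of length at least `1 / (m + 1)` from `z`, with `m` locally uniform.
  -- Taking the least `m` at each point prevents the steps from shrinking near a limit.
  let Q : M → ℕ → Prop := fun z m ↦ P z → ∃ z', 1 / ((m : ℝ) + 1) ≤ dist z' z ∧ g.Causal z' z ∧ P z'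
  have hQ : ∀ z, ∃ m : ℕ, ∀ᶠ u in 𝓝 z, Q u m := by
    intro z
    obtain ⟨N, hNo, hzN, hN⟩ := hstep z
    obtain ⟨ε, hε, hball⟩ := Metric.isOpen_iff.1 hNo z hzN
    obtain ⟨m, hm⟩ := exists_nat_one_div_lt (half_pos hε)
    refine ⟨m, ?_⟩
    filter_upwards [Metric.ball_mem_nhds z (half_pos hε)] with u hu hPu
    have huN : u ∈ N := hball (Metric.ball_subset_ball (half_le_self hε.le) hu)
    obtain ⟨u', hu', hc, hP⟩ := hN u huN hPu
    refine ⟨u', ?_, hc, hP⟩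
    by_contra! hlt
    refine hu' (hball ?_)
    calc dist u' z ≤ dist u' u + dist u z := dist_triangle _ _ _
      _ < ε / 2 + ε / 2 := add_lt_add (hlt.trans hm) hu
      _ = ε := add_halves ε
  have hQ' : ∀ z, ∃ m, Q z m := fun z ↦ (hQ z).imp fun m hm ↦ hm.self_of_nhds
  classical
  have hnext : ∀ z, ∃ z', P z → 1 / ((Nat.find (hQ' z) : ℝ) + 1) ≤ dist z' z ∧
      g.Causal z' z ∧ P z' := by
    intro z
    by_cases hz : P z
    · obtain ⟨z', hz'⟩ := Nat.find_spec (hQ' z) hz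
      exact ⟨z', fun _ ↦ hz'⟩
    · exact ⟨z, fun h ↦ absurd h hz⟩
  choose f hf using hnext
  set z : ℕ → M := fun k ↦ f^[k] y with hz
  have hzs : ∀ k, z (k + 1) = f (z k) := fun k ↦ Function.iterate_succ_apply' f k y
  have hPz : ∀ k, P (z k) := by
    intro k
    induction k with
    | zero => exact ⟨Or.inl rfl, w, hw, hxw⟩
    | succ k ih => rw [hzs]; exact (hf _ ih).2.2
  -- For `z k ≪ u`, nearby points `w' i` also satisfy `w' i ≪ u`, so `p ≤ x i ≤ w' i ≪ u` and
  -- push-up gives `p ≪ u`.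
  obtain ⟨l, hl⟩ := hτ.exists_tendsto (z := z) (p := p)
    (fun k ↦ by rw [hzs]; exact (hf _ (hPz k)).2.1) (fun k u hu ↦ by
      obtain ⟨-, w', hw', hxw'⟩ := hPz k
      have hev : ∀ᶠ i in (𝒰 : Filter ι), g.Chronological (w' i) u :=
        hw' ((g.isOpen_setOf_chronological_left u).mem_nhds hu)
      obtain ⟨i, ⟨h1, h2⟩, h3⟩ := ((hpx.and hxw').and hev).exists
      exact (h1.trans h2).trans_chronological h3)
  obtain ⟨m, hm⟩ := hQ l
  have hdist : ∀ᶠ k in atTop, 1 / ((m : ℝ) + 1) ≤ dist (z (k + 1)) (z k) := by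
    filter_upwards [hl.eventually hm] with k hk
    have h1 : Nat.find (hQ' (z k)) ≤ m := Nat.find_min' _ hk
    rw [hzs]
    refine le_trans ?_ (hf _ (hPz k)).1
    gcongr
  have h0 : Tendsto (fun k ↦ dist (z (k + 1)) (z k)) atTop (𝓝 (dist l l)) :=
    ((tendsto_add_atTop_iff_nat 1).2 hl).dist hl
  rw [dist_self] at h0
  have h1 : 1 / ((m : ℝ) + 1) ≤ 0 := ge_of_tendsto h0 hdist
  have h2 : 0 < 1 / ((m : ℝ) + 1) := by positivity
  exact h2.not_ge h1

/-- The limit theorem is used twice: with future endpoints fixed at `q` it produces a limit `x ≤ q`,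
and with past endpoints fixed at `p` it gives `p ≤ x`. -/
theorem HasRegularCosmologicalVolume.isCompact_diamond (hτ : g.HasRegularCosmologicalVolume)
    (p q : M) : IsCompact (g.causalFuture p ∩ g.causalPast q) := by
  rw [isCompact_iff_ultrafilter_le_nhds']
  intro 𝒰 h𝒰
  have h1 : ∀ᶠ x in (𝒰 : Filter M), g.Causal p x := mem_of_superset h𝒰 inter_subset_left
  have h2 : ∀ᶠ x in (𝒰 : Filter M), g.Causal x q := mem_of_superset h𝒰 inter_subset_right
  obtain ⟨x, hx, hxq⟩ := hτ.exists_tendsto_causal 𝒰 (x := id) (w := fun _ ↦ q)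
    tendsto_const_nhds h2 h1
  obtain ⟨p', hp', hpx⟩ := hτ.exists_tendsto_causal 𝒰 (x := fun _ ↦ p) (w := id) (p := p) hx h1
    (Eventually.of_forall fun _ ↦ Or.inl rfl)
  rw [← tendsto_nhds_unique tendsto_const_nhds hp'] at hpx
  exact ⟨x, ⟨hpx, hxq⟩, hx⟩

/-- By push-up, the sets `I⁺(a) ∩ I⁻(b)` with `a ≪ p ≪ b` are causally convex. If none fits into
`U`, there are points outside `U` between `a k → p` and `b k → p`. They have a limit `x'` with `p ≤
x' ≤ p`, so `x' = p` by antisymmetry, a contradiction. -/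
theorem HasRegularCosmologicalVolume.isStronglyCausal (hτ : g.HasRegularCosmologicalVolume) :
    g.IsStronglyCausal := by
  intro p U hU
  have := metrizableSpace_of_chartedSpace n M
  let _ := TopologicalSpace.metrizableSpaceMetric M
  by_contra! hnot
  have hbad : ∀ a b, g.Chronological a p → g.Chronological p b →
      ∃ x ∉ U, g.Chronological a x ∧ g.Chronological x b := by
    intro a b ha hb
    by_contra! h
    refine hnot {x | g.Chronological a x ∧ g.Chronological x b} (fun x hx ↦ ?_)
      ((g.isOpen_setOf_chronological_right a).inter (g.isOpen_setOf_chronological_left b))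
      ⟨ha, hb⟩ fun γ hγ h0 h1 t ht ↦ ⟨?_, ?_⟩
    · by_contra hxU
      exact h x hxU hx.1 hx.2
    · exact h0.1.trans_causal ((hγ.mono (Icc_subset_Icc le_rfl ht.2)).causal ht.1)
    · exact ((hγ.mono (Icc_subset_Icc ht.1 le_rfl)).causal ht.2).trans_chronological h1.2
  -- A common lower bound of all `a k`, as required by `exists_tendsto_causal`.
  obtain ⟨a₀, -, ha₀⟩ := (g.exists_chronological_mem_nhds p univ_mem).2
  have hseq : ∀ k : ℕ, ∃ a b, g.Chronological a₀ a ∧ g.Chronological a p ∧ g.Chronological p b ∧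
      dist a p < 1 / ((k : ℝ) + 1) ∧ dist b p < 1 / ((k : ℝ) + 1) := by
    intro k
    have hb := Metric.ball_mem_nhds p (ε := 1 / ((k : ℝ) + 1)) (by positivity)
    obtain ⟨b, hb1, hb2⟩ := (g.exists_chronological_mem_nhds p hb).1
    obtain ⟨a, ha1, ha2⟩ := (g.exists_chronological_mem_nhds p
      (inter_mem hb ((g.isOpen_setOf_chronological_right a₀).mem_nhds ha₀))).2
    exact ⟨a, b, ha1.2, ha2, hb2, ha1.1, hb1⟩
  choose a b ha₀a hap hpb hda hdb using hseq
  choose x hxU hax hxb using fun k ↦ hbad (a k) (b k) (hap k) (hpb k)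
  have hlim : ∀ {c : ℕ → M}, (∀ k, dist (c k) p < 1 / ((k : ℝ) + 1)) → Tendsto c atTop (𝓝 p) :=
    fun h ↦ tendsto_iff_dist_tendsto_zero.2 (squeeze_zero (fun _ ↦ dist_nonneg)
      (fun k ↦ (h k).le) tendsto_one_div_add_atTop_nhds_zero_nat)
  have h𝒰 : ((hyperfilter ℕ : Ultrafilter ℕ) : Filter ℕ) ≤ atTop := Nat.hyperfilter_le_atTop
  have hat := (hlim hda).mono_left h𝒰
  have hbt := (hlim hdb).mono_left h𝒰
  obtain ⟨x', hx', hx'p⟩ := hτ.exists_tendsto_causal (hyperfilter ℕ) (p := a₀) hbt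
    (Eventually.of_forall fun k ↦ (hxb k).causal)
    (Eventually.of_forall fun k ↦ (ha₀a k).causal.trans (hax k).causal)
  obtain ⟨a', ha', ha'x⟩ := hτ.exists_tendsto_causal (hyperfilter ℕ) (p := a₀) hx'
    (Eventually.of_forall fun k ↦ (hax k).causal) (Eventually.of_forall fun k ↦ (ha₀a k).causal)
  rw [tendsto_nhds_unique ha' hat] at ha'x
  rw [← hτ.causal_antisymm ha'x hx'p] at hx'
  obtain ⟨k, hk⟩ := (hx'.eventually hU).exists
  exact hxU k hk

end Regular

end Spacetime

theorem mainTheorem3 {n : ℕ} {M : Type*} [TopologicalSpace M] [T2Space M]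
    [SecondCountableTopology M] [ChartedSpace (EuclideanSpace ℝ (Fin n)) M]
    [IsManifold (𝓡 n) ∞ M] [MeasurableSpace M] [BorelSpace M]
    (g : Spacetime n M) (hτ : g.HasRegularCosmologicalVolume) :
    g.IsGloballyHyperbolic :=
  ⟨hτ.isStronglyCausal, hτ.isCompact_diamond⟩
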